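/- Let $0<H\le 1$ and let $(B(t))_{t\ge 0}$ be standard fractional Brownian motion with Hurst parameter $H$, i.e. a real-valued mean-zero Gaussian process on a probability space with $\mathrm{Var}_H(B(1))=1$ and $$\mathrm{Cov}_H(B(t),B(s))=\tfrac12\big(t^{2H}+s^{2H}-|t-s|^{2H}\big)\quad\text{for all } s,t\ge 0.$$ Let $X_k=B(k)$ for $k=0,1,2,\dots$ and $Y_k=X_k-X_{k-1}$ for $k\ge 1$; let $\rho_H(1)=\mathrm{Cov}_H(Y_1,Y_2)$ $(=2^{2H-1}-1)$. For $k\ge 0$ let $$C_k=\mathbf 1_{\{X_k\ge X_{k+1}<X_{k+2}\}}+\mathbf 1_{\{X_k<X_{k+1}\ge X_{k+2}\}}$$ be the indicator of a change between up and down at time $k$, and let $\gamma_H(k)=\mathrm{Cov}_H(C_0,C_k)$. Then $$\gamma_H(k)\ \sim\ \frac{2(1-\rho_H(1))}{\pi^2(1+\rho_H(1))}\,H^2(2H-1)^2\,k^{4H-4}\qquad\text{as } k\to\infty,$$ where $f(k)\sim g(k)$ means $\lim_{k\to\infty}f(k)/g(k)=1$ with the convention $\tfrac00:=1$ (so that for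 $H=\tfrac12$ and $H=1$, where the right-hand side vanishes for all $k\ge 1$, the claim is that $\gamma_H(k)=0$ for all sufficiently large $k$). -/

import Mathlib

open MeasureTheory ProbabilityTheory Filter Asymptotics
open scoped NNReal

/-- Fractional Brownian motion with Hurst parameter `H`: a mean-zero Gaussian process indexed by
`[0, ∞)` with
`Cov(B(t), B(s)) = (1/2) (t ^ (2H) + s ^ (2H) - |t - s| ^ (2H)) Var(B(1))`. -/
structure IsFractionalBrownianMotion {Ω : Type*} [MeasurableSpace Ω] (H : ℝ)
    (B : ℝ≥0 → Ω → ℝ) (P : Measure Ω) : Prop where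
  hurst_pos : 0 < H
  hurst_le_one : H ≤ 1
  isGaussianProcess : IsGaussianProcess B P
  mean_zero : ∀ t : ℝ≥0, ∫ ω, B t ω ∂P = 0
  covariance_eq : ∀ t s : ℝ≥0,
    cov[B t, B s; P] =
      1 / 2 * ((t : ℝ) ^ (2 * H) + (s : ℝ) ^ (2 * H) - |(t : ℝ) - (s : ℝ)| ^ (2 * H))
        * Var[B 1; P]

/-- Standard fractional Brownian motion: normalized by `Var(B(1)) = 1`. -/
structure IsStandardFractionalBrownianMotion {Ω : Type*} [MeasurableSpace Ω] (H : ℝ)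
    (B : ℝ≥0 → Ω → ℝ) (P : Measure Ω) : Prop extends IsFractionalBrownianMotion H B P where
  variance_one : Var[B 1; P] = 1

/-- The discretization `X_k = B(k)`, `k = 0, 1, 2, …`. -/
def discretization {Ω : Type*} (B : ℝ≥0 → Ω → ℝ) (k : ℕ) (ω : Ω) : ℝ :=
  B (k : ℝ≥0) ω

/-- The increments `Y_k = X_k - X_{k-1}`; meaningful for `k ≥ 1`. -/
def increment {Ω : Type*} (X : ℕ → Ω → ℝ) (k : ℕ) (ω : Ω) : ℝ :=
  X k ω - X (k - 1) ω

/-- The autocovariance `ρ(k) = Cov(Y_1, Y_{1+k})` of the increments of the discretization of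
`B`. -/
noncomputable def incrementAutocovariance {Ω : Type*} [MeasurableSpace Ω]
    (B : ℝ≥0 → Ω → ℝ) (P : Measure Ω) (k : ℕ) : ℝ :=
  cov[increment (discretization B) 1, increment (discretization B) (1 + k); P]

/-- The indicator `C_k` of a change between up and down at time `k`:
`1{X_k ≥ X_{k+1} < X_{k+2}} + 1{X_k < X_{k+1} ≥ X_{k+2}}`. -/
noncomputable def changeIndicator {Ω : Type*} (X : ℕ → Ω → ℝ) (k : ℕ) (ω : Ω) : ℝ :=
  Set.indicator {ω' | X k ω' ≥ X (k + 1) ω' ∧ X (k + 1) ω' < X (k + 2) ω'} (fun _ => (1 : ℝ)) ω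
  + Set.indicator {ω' | X k ω' < X (k + 1) ω' ∧ X (k + 1) ω' ≥ X (k + 2) ω'}
      (fun _ => (1 : ℝ)) ω

/-- The autocovariance `γ(k) = Cov(C_0, C_k)` of the change indicators of the discretization of
`B`. -/
noncomputable def changeAutocovariance {Ω : Type*} [MeasurableSpace Ω]
    (B : ℝ≥0 → Ω → ℝ) (P : Measure Ω) (k : ℕ) : ℝ :=
  cov[changeIndicator (discretization B) 0, changeIndicator (discretization B) k; P]

/-!
The up/down change indicator is `C_k = (1 - s(Y_{k+1}) s(Y_{k+2})) / 2`, where `s` is the sign with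
`s(0) = -1` and `Y` is the increment sequence, so `γ(k)` is a quarter of the covariance of
`s(Y_1) s(Y_2)` and `s(Y_{k+1}) s(Y_{k+2})`. For large `k` the two pairs of increments are nearly
independent: their four cross covariances are all asymptotic to `ε = H (2H - 1) k ^ (2H - 2)`
(`tendsto_fgnCov_add_div`).

The second pair is replaced by its sum `U` and difference `V`, which are independent, and the first
pair is regressed on them: `Y_i = N_i + p_i U + q_i V` with `(N_1, N_2)` independent of `(U, V)`,
where `p_i ~ ε / (1 + ρ(1))` and `q_i = o(ε)`. Conditioning on `(U, V)` expresses the covariance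
through the function `F(m, n) = E[s(N_1 + m) s(N_2 + n)]` (`meanSignMul`) evaluated at the random
shifts `p_i U + q_i V`; see `abs_covariance_upSign_mul_signPair_sub_le`. The function `F` has the
expansion `F(m, n) = F(0, 0) + Q(m, n) + O((|m| + |n|) ^ 4)` with an explicit quadratic form `Q`
(`shiftForm`) and an error that is uniform as long as the covariance determinant of `(N_1, N_2)`
stays away from `0` (`abs_meanSignMul_sub_le`). It rests on the fact that shifting the argument of a
sign changes it only on an interval, over which the Gaussian density can be integrated directly
(`integral_upSign_sub_mul`).

Since `F(0, 0)` drops out of the covariance and `Q` is quadratic, the leading term is proportional to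
`ε ^ 2` times the covariance of `U ^ 2` and `s(U + V) s(U - V)`, which is computed in closed form in
`integral_sq_mul_signPair_sub`; the error is `O(ε ^ 4)`. This gives
`tendsto_covariance_upSign_mul_upSign`, hence the claim when `H` is neither `1 / 2` nor `1`. For
`H = 1 / 2` the cross covariances vanish, and for `H = 1` the increments coincide almost surely; in
both cases the change indicators have covariance exactly `0` for large `k`.
-/

/-! ### Signs and Gaussian densities -/

/-- The sign of a real number with the convention that `0` counts as negative. -/
noncomputable def upSign (x : ℝ) : ℝ := if 0 < x then 1 else -1

lemma measurable_upSign : Measurable upSign :=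
  Measurable.ite measurableSet_Ioi measurable_const measurable_const

lemma abs_upSign (x : ℝ) : |upSign x| = 1 := by
  unfold upSign; split_ifs <;> simp

lemma upSign_mul_pos {c : ℝ} (hc : 0 < c) (x : ℝ) : upSign (c * x) = upSign x := by
  simp [upSign, mul_pos_iff_of_pos_left hc]

lemma upSign_neg {x : ℝ} (hx : x ≠ 0) : upSign (-x) = -upSign x := by
  unfold upSign
  rcases lt_or_gt_of_ne hx with h | h
  · simp [h, h.not_gt]
  · simp [h, h.le]

lemma gaussianPDFReal_zero_zero (v : ℝ≥0) :
    gaussianPDFReal 0 v 0 = (√(2 * Real.pi * v))⁻¹ := by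
  simp [gaussianPDFReal]

lemma continuous_gaussianPDFReal (μ : ℝ) (v : ℝ≥0) : Continuous (gaussianPDFReal μ v) := by
  unfold gaussianPDFReal
  fun_prop

lemma gaussianPDFReal_le_zero (v : ℝ≥0) (x : ℝ) :
    gaussianPDFReal 0 v x ≤ gaussianPDFReal 0 v 0 := by
  unfold gaussianPDFReal
  gcongr ?_ * Real.exp (?_ / ?_)
  nlinarith [sq_nonneg x]

lemma abs_gaussianPDFReal_sub_le (v : ℝ≥0) (x : ℝ) :
    |gaussianPDFReal 0 v x - gaussianPDFReal 0 v 0|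
      ≤ gaussianPDFReal 0 v 0 * (x ^ 2 / (2 * v)) := by
  rw [abs_sub_comm, abs_of_nonneg (sub_nonneg.2 (gaussianPDFReal_le_zero v x))]
  have h := Real.one_sub_le_exp_neg (x ^ 2 / (2 * v))
  have h0 : gaussianPDFReal 0 v x = gaussianPDFReal 0 v 0 * Real.exp (-(x ^ 2 / (2 * v))) := by
    simp [gaussianPDFReal, neg_div]
  rw [h0]
  nlinarith [gaussianPDFReal_nonneg 0 v 0]

/-- Moving the threshold of a sign by `u` only changes it between `-u` and `0`. No integrability
is needed: both sides are the integral of the same function. -/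
lemma integral_upSign_sub_mul {v : ℝ≥0} (hv : v ≠ 0) (u : ℝ) (g : ℝ → ℝ) :
    ∫ x, (upSign (x + u) - upSign x) * g x ∂(gaussianReal 0 v)
      = 2 * ∫ x in (-u)..0, gaussianPDFReal 0 v x * g x := by
  rw [integral_gaussianReal_eq_integral_smul hv]
  rcases le_total 0 u with hu | hu
  · rw [intervalIntegral.integral_of_le (by linarith), ← integral_const_mul,
      ← integral_indicator measurableSet_Ioc]
    congr with x
    simp only [Set.indicator, Set.mem_Ioc, upSign, smul_eq_mul]
    split_ifs <;> first | ring1 | (exfalso; grind)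
  · rw [intervalIntegral.integral_of_ge (by linarith), mul_neg, ← neg_mul, ← integral_const_mul,
      ← integral_indicator measurableSet_Ioc]
    congr with x
    simp only [Set.indicator, Set.mem_Ioc, upSign, smul_eq_mul]
    split_ifs <;> first | ring1 | (exfalso; grind)

lemma integrable_of_abs_le_one {α : Type*} [MeasurableSpace α] {μ : Measure α}
    [IsFiniteMeasure μ] {f : α → ℝ} (hf : AEStronglyMeasurable f μ) (h : ∀ x, |f x| ≤ 1) :
    Integrable f μ :=
  Integrable.of_bound hf 1 (ae_of_all _ h)

lemma integral_upSign_gaussianReal {w : ℝ≥0} (hw : w ≠ 0) :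
    ∫ z, upSign z ∂(gaussianReal 0 w) = 0 := by
  have := nullSingletonClass_gaussianReal (μ := 0) hw
  have h1 : ∫ z, upSign z ∂(gaussianReal 0 w) = ∫ z, upSign (-z) ∂(gaussianReal 0 w) := by
    conv_lhs => rw [← neg_zero, ← gaussianReal_map_neg]
    rw [integral_map (by fun_prop) measurable_upSign.aestronglyMeasurable]
  have h2 : ∫ z, upSign (-z) ∂(gaussianReal 0 w) = ∫ z, -upSign z ∂(gaussianReal 0 w) := by
    apply integral_congr_ae
    filter_upwards [Measure.ae_ne (gaussianReal 0 w) (0 : ℝ)] with z hz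
    exact upSign_neg hz
  rw [integral_neg] at h2
  linarith

/-- The mean sign of a centred Gaussian variable of variance `w` shifted by `y`. -/
noncomputable def meanSign (w : ℝ≥0) (y : ℝ) : ℝ := ∫ z, upSign (z + y) ∂(gaussianReal 0 w)

lemma meanSign_eq {w : ℝ≥0} (hw : w ≠ 0) (y : ℝ) :
    meanSign w y = 2 * ∫ x in (-y)..0, gaussianPDFReal 0 w x := by
  have h := integral_upSign_sub_mul hw y (fun _ => 1)
  simp only [mul_one] at h
  rw [integral_sub, integral_upSign_gaussianReal hw, sub_zero] at h
  · exact h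
  · exact integrable_of_abs_le_one
      (measurable_upSign.comp (measurable_id.add_const y)).aestronglyMeasurable
      fun x => (abs_upSign _).le
  · exact integrable_of_abs_le_one measurable_upSign.aestronglyMeasurable
      fun x => (abs_upSign _).le

lemma continuous_meanSign {w : ℝ≥0} (hw : w ≠ 0) : Continuous (meanSign w) := by
  have h : meanSign w = fun y => -(2 * ∫ x in (0 : ℝ)..(-y), gaussianPDFReal 0 w x) := by
    ext y
    rw [meanSign_eq hw, intervalIntegral.integral_symm, mul_neg]
  rw [h]
  have h1 : Continuous fun y : ℝ => ∫ x in (0 : ℝ)..y, gaussianPDFReal 0 w x :=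
    intervalIntegral.continuous_primitive
      (fun a b => (continuous_gaussianPDFReal 0 w).intervalIntegrable a b) 0
  exact (continuous_const.mul (h1.comp continuous_neg)).neg

lemma abs_meanSign_le {w : ℝ≥0} (hw : w ≠ 0) (y : ℝ) :
    |meanSign w y| ≤ 2 * gaussianPDFReal 0 w 0 * |y| := by
  rw [meanSign_eq hw, abs_mul, abs_two, mul_assoc]
  gcongr
  have := intervalIntegral.norm_integral_le_of_norm_le_const (a := -y) (b := 0)
    (f := gaussianPDFReal 0 w) (C := gaussianPDFReal 0 w 0) fun x _ => by
      rw [Real.norm_of_nonneg (gaussianPDFReal_nonneg _ _ _)]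
      exact gaussianPDFReal_le_zero w x
  simpa using this

lemma abs_le_abs_of_mem_uIoc {x y : ℝ} (hx : x ∈ Set.uIoc (-y) 0) : |x| ≤ |y| := by
  rw [Set.mem_uIoc] at hx
  rcases hx with hx | hx
  · rw [abs_of_nonpos hx.2, abs_of_pos (by linarith)]; linarith
  · rw [abs_of_pos hx.1, abs_of_neg (by linarith)]; linarith

lemma abs_meanSign_sub_le {w : ℝ≥0} (hw : w ≠ 0) (y : ℝ) :
    |meanSign w y - 2 * gaussianPDFReal 0 w 0 * y|
      ≤ gaussianPDFReal 0 w 0 * (|y| ^ 3 / w) := by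
  have h0 : meanSign w y - 2 * gaussianPDFReal 0 w 0 * y
      = 2 * ∫ x in (-y)..0, (gaussianPDFReal 0 w x - gaussianPDFReal 0 w 0) := by
    rw [intervalIntegral.integral_sub
      ((continuous_gaussianPDFReal 0 w).intervalIntegrable _ _) (by simp), meanSign_eq hw]
    simp; ring
  rw [h0, abs_mul, abs_two]
  have := intervalIntegral.norm_integral_le_of_norm_le_const (a := -y) (b := 0)
    (f := fun x => gaussianPDFReal 0 w x - gaussianPDFReal 0 w 0)
    (C := gaussianPDFReal 0 w 0 * (|y| ^ 2 / (2 * w))) fun x hx => by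
      refine (abs_gaussianPDFReal_sub_le w x).trans ?_
      have := gaussianPDFReal_nonneg 0 w 0
      have := abs_le_abs_of_mem_uIoc hx
      rw [← sq_abs x]
      gcongr
  simp only [Real.norm_eq_abs, sub_neg_eq_add, zero_add] at this
  calc _ ≤ 2 * (gaussianPDFReal 0 w 0 * (|y| ^ 2 / (2 * w)) * |y|) := by gcongr
    _ = _ := by ring

/-- Second-order expansion of the effect of moving the first of two thresholds for the pair
`(X, β X + Z)`, with `X` and `Z` independent centred Gaussian of variances `v` and `w`. -/
lemma abs_integral_upSign_sub_mul_meanSign_sub_le {v w : ℝ≥0} (hv : v ≠ 0) (hw : w ≠ 0)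
    (β m n : ℝ) :
    |∫ x, (upSign (x + m) - upSign x) * meanSign w (β * x + n) ∂(gaussianReal 0 v)
        - 4 * gaussianPDFReal 0 v 0 * gaussianPDFReal 0 w 0 * (m * n - β * m ^ 2 / 2)|
      ≤ 2 * gaussianPDFReal 0 v 0 * gaussianPDFReal 0 w 0
          * ((1 + |β|) / v + (1 + |β|) ^ 3 / w) * (|m| + |n|) ^ 4 := by
  set a := gaussianPDFReal 0 v 0 with ha
  set b := gaussianPDFReal 0 w 0 with hb
  have ha0 : 0 ≤ a := gaussianPDFReal_nonneg 0 v 0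
  have hb0 : 0 ≤ b := gaussianPDFReal_nonneg 0 w 0
  have hlin : 4 * a * b * (m * n - β * m ^ 2 / 2)
      = 2 * ∫ x in (-m)..0, a * (2 * b * (β * x + n)) := by
    have hi : ∫ x in (-m)..0, a * (2 * b * (β * x + n)) = 2 * a * b * (m * n - β * m ^ 2 / 2) := by
      simp_rw [← mul_assoc]
      rw [intervalIntegral.integral_const_mul, intervalIntegral.integral_add
        (by apply Continuous.intervalIntegrable; fun_prop) (by simp),
        intervalIntegral.integral_const_mul, integral_id]
      simp; ring
    rw [hi]; ring
  have hcont : Continuous fun x => gaussianPDFReal 0 v x * meanSign w (β * x + n) :=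
    (continuous_gaussianPDFReal 0 v).mul ((continuous_meanSign hw).comp (by fun_prop))
  rw [integral_upSign_sub_mul hv, hlin, ← mul_sub, ← intervalIntegral.integral_sub
    (hcont.intervalIntegrable _ _)
    (by apply Continuous.intervalIntegrable; fun_prop), abs_mul, abs_two]
  set M := |m| + |n| with hM
  have hM0 : 0 ≤ M := by positivity
  have hbd := intervalIntegral.norm_integral_le_of_norm_le_const (a := -m) (b := 0)
    (f := fun x => gaussianPDFReal 0 v x * meanSign w (β * x + n) - a * (2 * b * (β * x + n)))
    (C := a * b * ((1 + |β|) / v + (1 + |β|) ^ 3 / w) * M ^ 3) fun x hx => by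
      have hx' := abs_le_abs_of_mem_uIoc hx
      have hxM : |x| ≤ M := hx'.trans (by simp [hM])
      have hy : |β * x + n| ≤ (1 + |β|) * M := by
        calc |β * x + n| ≤ |β| * |x| + |n| := by rw [← abs_mul]; exact abs_add_le _ _
          _ ≤ |β| * M + M := by gcongr; simp [hM]
          _ = _ := by ring
      have e1 := abs_gaussianPDFReal_sub_le v x
      have e2 := abs_meanSign_sub_le hw (β * x + n)
      have e3 := abs_meanSign_le hw (β * x + n)
      rw [← ha] at e1
      rw [← hb] at e2 e3
      have : gaussianPDFReal 0 v x * meanSign w (β * x + n) - a * (2 * b * (β * x + n))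
          = (gaussianPDFReal 0 v x - a) * meanSign w (β * x + n)
            + a * (meanSign w (β * x + n) - 2 * b * (β * x + n)) := by ring
      rw [this, Real.norm_eq_abs]
      refine (abs_add_le _ _).trans ?_
      rw [abs_mul, abs_mul, abs_of_nonneg ha0]
      calc _ ≤ (a * (x ^ 2 / (2 * v))) * (2 * b * |β * x + n|)
            + a * (b * (|β * x + n| ^ 3 / w)) := by gcongr
        _ ≤ (a * (M ^ 2 / (2 * v))) * (2 * b * ((1 + |β|) * M))
            + a * (b * (((1 + |β|) * M) ^ 3 / w)) := by
              rw [← sq_abs x]; gcongr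
        _ = _ := by ring
  simp only [Real.norm_eq_abs, sub_neg_eq_add, zero_add] at hbd
  calc _ ≤ 2 * (a * b * ((1 + |β|) / v + (1 + |β|) ^ 3 / w) * M ^ 3 * |m|) := by gcongr
    _ ≤ 2 * (a * b * ((1 + |β|) / v + (1 + |β|) ^ 3 / w) * M ^ 3 * M) := by
        gcongr; simp [hM]
    _ = _ := by ring

/-! ### Signs of a shifted Gaussian pair -/

section Independence

variable {Ω : Type*} [MeasurableSpace Ω] {P : Measure Ω} [IsProbabilityMeasure P]

lemma integral_comp_of_indepFun {E F : Type*} [MeasurableSpace E] [MeasurableSpace F]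
    {X : Ω → E} {Z : Ω → F} (hX : AEMeasurable X P) (hZ : AEMeasurable Z P) (h : IndepFun X Z P)
    {f : E × F → ℝ} (hf : Measurable f) (hi : Integrable f ((P.map X).prod (P.map Z))) :
    ∫ ω, f (X ω, Z ω) ∂P = ∫ x, ∫ z, f (x, z) ∂(P.map Z) ∂(P.map X) := by
  have : IsProbabilityMeasure (P.map X) := Measure.isProbabilityMeasure_map hX
  have : IsProbabilityMeasure (P.map Z) := Measure.isProbabilityMeasure_map hZ
  rw [← integral_prod _ hi, ← (indepFun_iff_map_prod_eq_prod_map_map hX hZ).1 h,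
    integral_map (hX.prodMk hZ) hf.aestronglyMeasurable]

/-- The constant in the fourth-order error term of the expansion of `E[s(X + m) s(Y + n)]`, where
`δ` is a lower bound for the determinant of the covariance matrix of `(X, Y)`. -/
noncomputable def expansionConst (δ : ℝ) : ℝ :=
  1 / (Real.pi * √δ) * ((1 + 1 / δ) / δ + (1 + 1 / δ) ^ 3 / δ)

lemma expansionConst_nonneg {δ : ℝ} (hδ : 0 < δ) : 0 ≤ expansionConst δ := by
  unfold expansionConst; positivity

lemma gaussianPDFReal_zero_mul_zero (v w : ℝ≥0) :
    gaussianPDFReal 0 v 0 * gaussianPDFReal 0 w 0 = 1 / (2 * Real.pi * √(v * w)) := by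
  rw [gaussianPDFReal_zero_zero, gaussianPDFReal_zero_zero, ← mul_inv,
    ← Real.sqrt_mul (by positivity),
    show 2 * Real.pi * (v : ℝ) * (2 * Real.pi * w) = (2 * Real.pi) ^ 2 * (v * w) by ring,
    Real.sqrt_mul (by positivity), Real.sqrt_sq (by positivity), one_div]

/-- Expansion of the effect of moving one of the two thresholds, for a centred Gaussian pair. It is
obtained by splitting `Y` into its regression on `X` and an independent residual. -/
lemma abs_integral_upSign_sub_mul_upSign_sub_le {X Y : Ω → ℝ} {s t q δ : ℝ}
    (hXY : HasGaussianLaw (fun ω => (X ω, Y ω)) P) (hX0 : ∫ ω, X ω ∂P = 0) (hY0 : ∫ ω, Y ω ∂P = 0)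
    (hs : Var[X; P] = s) (ht : Var[Y; P] = t) (hq : cov[X, Y; P] = q) (hs1 : s ≤ 1) (ht1 : t ≤ 1)
    (hδ : 0 < δ) (hD : δ ≤ s * t - q ^ 2) (m n : ℝ) :
    |∫ ω, (upSign (X ω + m) - upSign (X ω)) * upSign (Y ω + n) ∂P
        - 2 / (Real.pi * √(s * t - q ^ 2)) * (m * n - q / s * m ^ 2 / 2)|
      ≤ expansionConst δ * (|m| + |n|) ^ 4 := by
  have hX := hXY.fst
  have hY := hXY.snd
  have hs0 : 0 ≤ s := hs ▸ variance_nonneg _ _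
  have ht0 : 0 ≤ t := ht ▸ variance_nonneg _ _
  have hsδ : δ ≤ s := by nlinarith [sq_nonneg q]
  have hspos : 0 < s := hδ.trans_le hsδ
  set β := q / s with hβ
  have hβs : β * s = q := by rw [hβ]; field_simp
  set w := t - β * q with hwdef
  have hsw : s * w = s * t - q ^ 2 := by rw [hwdef, mul_sub, ← mul_assoc, mul_comm s β, hβs]; ring
  have hwδ : δ ≤ w := by
    have : s * w ≤ w := by
      have : 0 < w := pos_of_mul_pos_right (by rw [hsw]; linarith) hs0
      nlinarith
    linarith
  have hwpos : 0 < w := hδ.trans_le hwδ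
  set Z : Ω → ℝ := fun ω => Y ω - β * X ω with hZdef
  have hXm : MemLp X 2 P := hX.memLp_two
  have hYm : MemLp Y 2 P := hY.memLp_two
  have hβX : MemLp (fun ω => β * X ω) 2 P := hXm.const_mul β
  have hXZ : HasGaussianLaw (fun ω => (X ω, Z ω)) P := by
    have := hXY.map_fun ((ContinuousLinearMap.fst ℝ ℝ ℝ).prod
      (ContinuousLinearMap.snd ℝ ℝ ℝ - β • ContinuousLinearMap.fst ℝ ℝ ℝ))
    simpa [hZdef] using this
  have hZ := hXZ.snd
  have hcov : cov[X, Z; P] = 0 := by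
    rw [hZdef, covariance_fun_sub_right hXm hYm hβX, covariance_const_mul_right, hq,
      covariance_self hX.aemeasurable, hs, hβs, sub_self]
  have hind : IndepFun X Z P := hXZ.indepFun_of_covariance_eq_zero hcov
  have hvarZ : Var[Z; P] = w := by
    rw [← covariance_self hZ.aemeasurable, hZdef, covariance_fun_sub_fun_sub hYm hβX hYm hβX,
      covariance_const_mul_left, covariance_const_mul_left, covariance_const_mul_right,
      covariance_const_mul_right, covariance_comm Y X, hq, covariance_self hX.aemeasurable,
      covariance_self hY.aemeasurable, hs, ht, hβs]
    ring
  have hmeanZ : ∫ ω, Z ω ∂P = 0 := by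
    rw [hZdef, integral_sub hY.integrable (hX.integrable.const_mul β), integral_const_mul, hX0, hY0]
    simp
  have hlawX : P.map X = gaussianReal 0 s.toNNReal := by
    rw [hX.map_eq_gaussianReal, hX0, hs]
  have hlawZ : P.map Z = gaussianReal 0 w.toNNReal := by
    rw [hZ.map_eq_gaussianReal, hmeanZ, hvarZ]
  have hv0 : s.toNNReal ≠ 0 := (Real.toNNReal_pos.2 hspos).ne'
  have hw0 : w.toNNReal ≠ 0 := (Real.toNNReal_pos.2 hwpos).ne'
  have hmeas : Measurable fun x : ℝ × ℝ =>
      (upSign (x.1 + m) - upSign x.1) * upSign (x.2 + (β * x.1 + n)) := by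
    have := measurable_upSign
    fun_prop
  have hint : ∫ ω, (upSign (X ω + m) - upSign (X ω)) * upSign (Y ω + n) ∂P
      = ∫ x, (upSign (x + m) - upSign x) * meanSign w.toNNReal (β * x + n)
          ∂(gaussianReal 0 s.toNNReal) := by
    have h1 := integral_comp_of_indepFun hX.aemeasurable hZ.aemeasurable hind hmeas ?_
    · rw [hlawX, hlawZ] at h1
      simp only [integral_const_mul] at h1
      simp only [meanSign, ← h1, hZdef]
      refine integral_congr_ae (ae_of_all _ fun ω => ?_)
      simp only
      congr 2; ring
    · rw [hlawX, hlawZ]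
      refine Integrable.of_bound hmeas.aestronglyMeasurable 2 (ae_of_all _ fun x => ?_)
      rw [Real.norm_eq_abs, abs_mul, abs_upSign, mul_one]
      refine (abs_sub _ _).trans ?_
      rw [abs_upSign, abs_upSign]; norm_num
  have key := abs_integral_upSign_sub_mul_meanSign_sub_le hv0 hw0 β m n
  rw [mul_assoc 4, mul_assoc 2, gaussianPDFReal_zero_mul_zero, Real.coe_toNNReal s hs0,
    Real.coe_toNNReal w hwpos.le, hsw] at key
  rw [hint]
  have hβ1 : |β| ≤ 1 / δ := by
    have hq1 : |q| ≤ 1 := by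
      rw [← sq_le_one_iff_abs_le_one]
      nlinarith
    rw [hβ, abs_div, abs_of_pos hspos]
    gcongr
  calc _ = |∫ x, (upSign (x + m) - upSign x) * meanSign w.toNNReal (β * x + n)
          ∂(gaussianReal 0 s.toNNReal)
          - 4 * (1 / (2 * Real.pi * √(s * t - q ^ 2))) * (m * n - β * m ^ 2 / 2)| := by
        congr 2
        have : 0 < √(s * t - q ^ 2) := Real.sqrt_pos.2 (by linarith)
        have := Real.pi_pos
        field_simp
        ring
    _ ≤ _ := key
    _ ≤ 2 * (1 / (2 * Real.pi * √δ)) * ((1 + 1 / δ) / δ + (1 + 1 / δ) ^ 3 / δ)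
          * (|m| + |n|) ^ 4 := by gcongr
    _ = _ := by
        unfold expansionConst
        have : 0 < √δ := Real.sqrt_pos.2 hδ
        have := Real.pi_pos
        congr 2
        field_simp

/-- The second-order term of `E[s(X + m) s(Y + n)]` in the shifts `m` and `n`, for a centred
Gaussian pair with variances `s`, `t` and covariance `q`. -/
noncomputable def shiftForm (s t q m n : ℝ) : ℝ :=
  2 / (Real.pi * √(s * t - q ^ 2)) * (m * n - q / s * m ^ 2 / 2 - q / t * n ^ 2 / 2)

/-- The mean product of the signs of `X + m` and `Y + n`. -/
noncomputable def meanSignMul (P : Measure Ω) (X Y : Ω → ℝ) (m n : ℝ) : ℝ :=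
  ∫ ω, upSign (X ω + m) * upSign (Y ω + n) ∂P

/-- Expansion of the mean product of two shifted signs. The two thresholds are moved one after the
other; the mixed term `m * n` comes from the first move. -/
lemma abs_meanSignMul_sub_le {X Y : Ω → ℝ} {s t q δ : ℝ}
    (hXY : HasGaussianLaw (fun ω => (X ω, Y ω)) P) (hX0 : ∫ ω, X ω ∂P = 0) (hY0 : ∫ ω, Y ω ∂P = 0)
    (hs : Var[X; P] = s) (ht : Var[Y; P] = t) (hq : cov[X, Y; P] = q) (hs1 : s ≤ 1) (ht1 : t ≤ 1)
    (hδ : 0 < δ) (hD : δ ≤ s * t - q ^ 2) (m n : ℝ) :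
    |meanSignMul P X Y m n - meanSignMul P X Y 0 0 - shiftForm s t q m n|
      ≤ 2 * expansionConst δ * (|m| + |n|) ^ 4 := by
  have hX := hXY.fst
  have hY := hXY.snd
  have hYX : HasGaussianLaw (fun ω => (Y ω, X ω)) P := by
    have := hXY.map_fun ((ContinuousLinearMap.snd ℝ ℝ ℝ).prod (ContinuousLinearMap.fst ℝ ℝ ℝ))
    simpa using this
  have h1 := abs_integral_upSign_sub_mul_upSign_sub_le hXY hX0 hY0 hs ht hq hs1 ht1 hδ hD m n
  have h2 := abs_integral_upSign_sub_mul_upSign_sub_le hYX hY0 hX0 ht hs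
    ((covariance_comm _ _).trans hq) ht1 hs1 hδ (by rwa [mul_comm t s]) n 0
  have hint : ∀ a b : ℝ, Integrable (fun ω => upSign (X ω + a) * upSign (Y ω + b)) P := fun a b =>
    integrable_of_abs_le_one
      (((measurable_upSign.comp_aemeasurable (hX.aemeasurable.add_const a)).mul
        (measurable_upSign.comp_aemeasurable (hY.aemeasurable.add_const b))).aestronglyMeasurable)
      fun ω => by rw [abs_mul, abs_upSign, abs_upSign, one_mul]
  have e1 : ∫ ω, (upSign (X ω + m) - upSign (X ω)) * upSign (Y ω + n) ∂P
      = meanSignMul P X Y m n - meanSignMul P X Y 0 n := by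
    rw [meanSignMul, meanSignMul, ← integral_sub (hint _ _) (hint _ _)]
    simp only [add_zero, sub_mul]
  have e2 : ∫ ω, (upSign (Y ω + n) - upSign (Y ω)) * upSign (X ω + 0) ∂P
      = meanSignMul P X Y 0 n - meanSignMul P X Y 0 0 := by
    rw [meanSignMul, meanSignMul, ← integral_sub (hint _ _) (hint _ _)]
    congr with ω
    simp only [add_zero]; ring
  rw [e1] at h1
  rw [e2, mul_comm t s] at h2
  have hsplit : meanSignMul P X Y m n - meanSignMul P X Y 0 0 - shiftForm s t q m n
      = (meanSignMul P X Y m n - meanSignMul P X Y 0 n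
          - 2 / (Real.pi * √(s * t - q ^ 2)) * (m * n - q / s * m ^ 2 / 2))
        + (meanSignMul P X Y 0 n - meanSignMul P X Y 0 0
          - 2 / (Real.pi * √(s * t - q ^ 2)) * (n * 0 - q / t * n ^ 2 / 2)) := by
    unfold shiftForm; ring
  rw [hsplit]
  refine (abs_add_le _ _).trans ?_
  have hK := expansionConst_nonneg hδ
  calc _ ≤ expansionConst δ * (|m| + |n|) ^ 4 + expansionConst δ * (|n| + |(0 : ℝ)|) ^ 4 := by
        gcongr
    _ ≤ expansionConst δ * (|m| + |n|) ^ 4 + expansionConst δ * (|m| + |n|) ^ 4 := by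
        have : |n| + |(0 : ℝ)| ≤ |m| + |n| := by simp
        gcongr
    _ = _ := by ring

end Independence

/-! ### The sign pair of two independent Gaussian variables -/

/-- The product of the signs of `u + v` and `u - v` at `w = (u, v)`: up to null sets it is `1` where
`|v| < |u|` and `-1` where `|u| < |v|`. -/
noncomputable def signPair (w : ℝ × ℝ) : ℝ := upSign (w.1 + w.2) * upSign (w.1 - w.2)

lemma measurable_signPair : Measurable signPair := by
  have := measurable_upSign
  unfold signPair; fun_prop

lemma abs_signPair (w : ℝ × ℝ) : |signPair w| = 1 := by
  rw [signPair, abs_mul, abs_upSign, abs_upSign, one_mul]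

/-- This holds everywhere, including the boundary, because `upSign 0 = -1` matches the half-open
interval. -/
lemma signPair_eq (u v : ℝ) :
    signPair (u, v) = 1 - 2 * (Set.Ioc (-|v|) |v|).indicator (fun _ => 1) u := by
  simp only [signPair, upSign, Set.indicator, Set.mem_Ioc]
  rcases abs_cases v with ⟨h, _⟩ | ⟨h, _⟩ <;> rw [h] <;> split_ifs <;>
    first | (norm_num; done) | (exfalso; grind)

lemma integral_sq_gaussianReal (a : ℝ≥0) : ∫ u, u ^ 2 ∂(gaussianReal 0 a) = a := by
  rw [← variance_fun_id_gaussianReal (μ := 0) (v := a), variance_eq_integral (by fun_prop)]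
  simp

lemma integrable_pow_gaussianReal (a : ℝ≥0) (n : ℕ) :
    Integrable (fun u : ℝ => u ^ n) (gaussianReal 0 a) := by
  have h := (memLp_id_gaussianReal (μ := 0) (v := a) n).integrable_norm_pow'
  rw [← integrable_norm_iff (by fun_prop)]
  simpa using h

/-- The function `-a u φ(u)` is an antiderivative of `(u² - a) φ(u)`. -/
lemma integral_sq_sub_mul_gaussianPDFReal {a : ℝ≥0} (ha : a ≠ 0) (t : ℝ) :
    ∫ u in (-t)..t, gaussianPDFReal 0 a u * (u ^ 2 - a) = -2 * a * t * gaussianPDFReal 0 a t := by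
  have ha' : (a : ℝ) ≠ 0 := by exact_mod_cast ha
  have hd : ∀ u : ℝ, HasDerivAt (fun u => -a * u * gaussianPDFReal 0 a u)
      (gaussianPDFReal 0 a u * (u ^ 2 - a)) u := by
    intro u
    have h1 : HasDerivAt (fun u : ℝ => -(u - 0) ^ 2 / (2 * a)) (-u / a) u := by
      have := (((hasDerivAt_id u).sub_const 0).pow 2).neg.div_const (2 * (a : ℝ))
      refine this.congr_deriv ?_
      simp only [id_eq, sub_zero]; field_simp; norm_num
    have h2 : HasDerivAt (gaussianPDFReal 0 a) (gaussianPDFReal 0 a u * (-u / a)) u := by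
      have := h1.exp.const_mul (√(2 * Real.pi * a))⁻¹
      rw [← mul_assoc] at this
      exact this
    have h3 := ((hasDerivAt_id u).const_mul (-(a : ℝ))).mul h2
    refine h3.congr_deriv ?_
    simp only [id_eq]; field_simp; ring
  rw [intervalIntegral.integral_eq_sub_of_hasDerivAt (fun u _ => hd u)]
  · have : gaussianPDFReal 0 a (-t) = gaussianPDFReal 0 a t := by simp [gaussianPDFReal]
    rw [this]; ring
  · apply Continuous.intervalIntegrable
    have := continuous_gaussianPDFReal 0 a
    fun_prop

lemma integral_sq_sub_mul_signPair {a : ℝ≥0} (ha : a ≠ 0) (v : ℝ) :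
    ∫ u, (u ^ 2 - a) * signPair (u, v) ∂(gaussianReal 0 a)
      = 4 * a * (|v| * gaussianPDFReal 0 a v) := by
  have hi : Integrable (fun u : ℝ => u ^ 2 - (a : ℝ)) (gaussianReal 0 a) :=
    (integrable_pow_gaussianReal a 2).sub (integrable_const _)
  have h0 : ∫ u, (u ^ 2 - (a : ℝ)) ∂(gaussianReal 0 a) = 0 := by
    rw [integral_sub (integrable_pow_gaussianReal a 2) (integrable_const _),
      integral_sq_gaussianReal]
    simp
  have h1 : ∀ u : ℝ, (u ^ 2 - a) * signPair (u, v) = (u ^ 2 - a)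
      - 2 * (Set.Ioc (-|v|) |v|).indicator (fun u => u ^ 2 - (a : ℝ)) u := by
    intro u
    rw [signPair_eq]
    simp only [Set.indicator]
    split_ifs <;> ring
  simp_rw [h1]
  rw [integral_sub hi ((hi.indicator measurableSet_Ioc).const_mul 2), h0, integral_const_mul,
    integral_gaussianReal_eq_integral_smul ha]
  have h2 : ∀ u : ℝ, gaussianPDFReal 0 a u • (Set.Ioc (-|v|) |v|).indicator
      (fun u => u ^ 2 - (a : ℝ)) u = (Set.Ioc (-|v|) |v|).indicator
      (fun u => gaussianPDFReal 0 a u * (u ^ 2 - (a : ℝ))) u := by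
    intro u
    simp only [Set.indicator]
    split_ifs <;> simp
  simp_rw [h2]
  rw [integral_indicator measurableSet_Ioc,
    ← intervalIntegral.integral_of_le (neg_le_self (abs_nonneg v)),
    integral_sq_sub_mul_gaussianPDFReal ha]
  have : gaussianPDFReal 0 a |v| = gaussianPDFReal 0 a v := by simp [gaussianPDFReal]
  rw [this]; ring

lemma integral_abs_mul_exp_neg_mul_sq {c : ℝ} (hc : 0 < c) :
    ∫ v : ℝ, |v| * Real.exp (-c * v ^ 2) = 1 / c := by
  have h := integral_comp_abs (f := fun v : ℝ => v * Real.exp (-c * v ^ 2))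
  simp only [sq_abs] at h
  rw [h]
  have h2 := integral_mul_cexp_neg_mul_sq (b := (c : ℂ)) (by simpa using hc)
  have h3 : ((∫ r in Set.Ioi (0 : ℝ), r * Real.exp (-c * r ^ 2) : ℝ) : ℂ) = (2 * (c : ℂ))⁻¹ := by
    rw [← h2, ← integral_complex_ofReal]
    push_cast
    rfl
  have h4 : ∫ r in Set.Ioi (0 : ℝ), r * Real.exp (-c * r ^ 2) = (2 * c)⁻¹ := by
    exact_mod_cast h3
  rw [h4]; field_simp

lemma integral_abs_mul_gaussianPDFReal {a b : ℝ≥0} (ha : a ≠ 0) (hb : b ≠ 0) :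
    ∫ v, |v| * gaussianPDFReal 0 a v ∂(gaussianReal 0 b)
      = √(a * b) / (Real.pi * (a + b)) := by
  have ha' : 0 < (a : ℝ) := by exact_mod_cast pos_iff_ne_zero.2 ha
  have hb' : 0 < (b : ℝ) := by exact_mod_cast pos_iff_ne_zero.2 hb
  rw [integral_gaussianReal_eq_integral_smul hb]
  have h : ∀ v : ℝ, gaussianPDFReal 0 b v • (|v| * gaussianPDFReal 0 a v)
      = ((√(2 * Real.pi * b))⁻¹ * (√(2 * Real.pi * a))⁻¹)
        * (|v| * Real.exp (-((a + b) / (2 * (a * b)) : ℝ) * v ^ 2)) := by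
    intro v
    have : Real.exp (-((a + b) / (2 * (a * b)) : ℝ) * v ^ 2)
        = Real.exp (-(v - 0) ^ 2 / (2 * b)) * Real.exp (-(v - 0) ^ 2 / (2 * a)) := by
      rw [← Real.exp_add]; congr 1; field_simp; ring
    rw [this, smul_eq_mul, gaussianPDFReal, gaussianPDFReal]; ring
  simp_rw [h]
  rw [integral_const_mul, integral_abs_mul_exp_neg_mul_sq (by positivity), ← mul_inv,
    ← Real.sqrt_mul (by positivity),
    show 2 * Real.pi * (b : ℝ) * (2 * Real.pi * a) = (2 * Real.pi) ^ 2 * (a * b) by ring,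
    Real.sqrt_mul (by positivity), Real.sqrt_sq (by positivity)]
  have hs : 0 < √((a : ℝ) * b) := by positivity
  have hs2 : √((a : ℝ) * b) ^ 2 = a * b := Real.sq_sqrt (by positivity)
  have := Real.pi_pos
  field_simp
  rw [hs2]

section ProductLaw

variable (a b : ℝ≥0)

/-- The joint law of independent centred Gaussian variables of variances `a` and `b`. -/
noncomputable def gaussianPair : Measure (ℝ × ℝ) := (gaussianReal 0 a).prod (gaussianReal 0 b)

instance : IsProbabilityMeasure (gaussianPair a b) := by
  unfold gaussianPair; infer_instance

lemma integrable_pow_mul_pow_gaussianPair (i j : ℕ) :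
    Integrable (fun w : ℝ × ℝ => w.1 ^ i * w.2 ^ j) (gaussianPair a b) :=
  (integrable_pow_gaussianReal a i).mul_prod (integrable_pow_gaussianReal b j)

lemma integrable_abs_add_abs_pow_four_gaussianPair :
    Integrable (fun w : ℝ × ℝ => (|w.1| + |w.2|) ^ 4) (gaussianPair a b) := by
  have h := ((integrable_pow_mul_pow_gaussianPair a b 4 0).add
    (integrable_pow_mul_pow_gaussianPair a b 0 4)).const_mul 8
  refine h.mono' (by fun_prop) (ae_of_all _ fun w => ?_)
  rw [Real.norm_of_nonneg (by positivity)]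
  have h4 : ∀ x : ℝ, x ^ 4 = |x| ^ 4 := fun x => by rw [← abs_pow, abs_of_nonneg (by positivity)]
  simp only [Pi.add_apply, pow_zero, one_mul, mul_one]
  rw [h4 w.1, h4 w.2]
  have := add_pow_le (abs_nonneg w.1) (abs_nonneg w.2) 4
  norm_num at this
  exact this

lemma integrable_mul_signPair_sub {f : ℝ × ℝ → ℝ} (hf : Integrable f (gaussianPair a b)) (c : ℝ) :
    Integrable (fun w => f w * (signPair w - c)) (gaussianPair a b) := by
  refine hf.mul_bdd (c := 1 + |c|) (measurable_signPair.sub_const c).aestronglyMeasurable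
    (ae_of_all _ fun w => ?_)
  refine (abs_sub _ _).trans ?_
  rw [abs_signPair]

variable {a b}

/-- The covariance of `u ^ 2` with the sign pair, which is the source of the constant in the
asymptotics. It is computed by integrating over `u` first. -/
lemma integral_sq_mul_signPair_sub (ha : a ≠ 0) (hb : b ≠ 0) :
    ∫ w, w.1 ^ 2 * (signPair w - ∫ z, signPair z ∂(gaussianPair a b)) ∂(gaussianPair a b)
      = 4 * a * √(a * b) / (Real.pi * (a + b)) := by
  set c := ∫ z, signPair z ∂(gaussianPair a b) with hc
  have h2 : Integrable (fun w : ℝ × ℝ => w.1 ^ 2) (gaussianPair a b) := by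
    simpa using integrable_pow_mul_pow_gaussianPair a b 2 0
  have hs : Integrable signPair (gaussianPair a b) :=
    integrable_of_abs_le_one measurable_signPair.aestronglyMeasurable fun w => (abs_signPair w).le
  have hi : Integrable (fun w : ℝ × ℝ => (w.1 ^ 2 - a) * signPair w) (gaussianPair a b) := by
    simpa using integrable_mul_signPair_sub a b (h2.sub (integrable_const (a : ℝ))) 0
  have hsq : ∫ w, w.1 ^ 2 ∂(gaussianPair a b) = a := by
    rw [gaussianPair, integral_fun_fst (fun u : ℝ => u ^ 2), integral_sq_gaussianReal]; simp
  have e : ∫ w, w.1 ^ 2 * (signPair w - c) ∂(gaussianPair a b)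
      = ∫ w, (w.1 ^ 2 - a) * signPair w ∂(gaussianPair a b) := by
    have h : ∀ w : ℝ × ℝ, w.1 ^ 2 * (signPair w - c)
        = (w.1 ^ 2 - a) * signPair w + (a * signPair w - c * w.1 ^ 2) := fun w => by ring
    simp_rw [h]
    have hd : Integrable (fun w => a * signPair w - c * w.1 ^ 2) (gaussianPair a b) :=
      (hs.const_mul _).sub (h2.const_mul _)
    rw [integral_add hi hd, integral_sub (hs.const_mul _) (h2.const_mul _), integral_const_mul,
      integral_const_mul, hsq,
      ← hc]
    ring
  rw [e, gaussianPair, integral_prod_symm _ hi]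
  simp only [integral_sq_sub_mul_signPair ha, integral_const_mul,
    integral_abs_mul_gaussianPDFReal ha hb]
  ring

end ProductLaw

/-! ### Decoupling -/

section Decoupling

variable {Ω : Type*} [MeasurableSpace Ω] {P : Measure Ω} [IsProbabilityMeasure P]

/-- The covariance of the monomial `u ^ i * v ^ j` with the sign pair of `(u, v)`, for independent
centred Gaussian `u` and `v`. -/
noncomputable def signPairMoment (a b : ℝ≥0) (i j : ℕ) : ℝ :=
  ∫ w, w.1 ^ i * w.2 ^ j * (signPair w - ∫ z, signPair z ∂(gaussianPair a b)) ∂(gaussianPair a b)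

lemma integrable_monomial_mul_signPair_sub (a b : ℝ≥0) (i j : ℕ) (c : ℝ) :
    Integrable (fun w : ℝ × ℝ => w.1 ^ i * w.2 ^ j * (signPair w - c)) (gaussianPair a b) :=
  integrable_mul_signPair_sub a b (integrable_pow_mul_pow_gaussianPair a b i j) c

/-- The shift form along linear shifts, as a quadratic polynomial in `w`; the coefficient of the
mixed monomial is written by polarization. -/
lemma shiftForm_linear_eq (s t q p₁ q₁ p₂ q₂ : ℝ) (w : ℝ × ℝ) :
    shiftForm s t q (p₁ * w.1 + q₁ * w.2) (p₂ * w.1 + q₂ * w.2)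
      = shiftForm s t q p₁ p₂ * (w.1 ^ 2 * w.2 ^ 0)
        + (shiftForm s t q (p₁ + q₁) (p₂ + q₂) - shiftForm s t q p₁ p₂ - shiftForm s t q q₁ q₂)
          * (w.1 ^ 1 * w.2 ^ 1)
        + shiftForm s t q q₁ q₂ * (w.1 ^ 0 * w.2 ^ 2) := by
  unfold shiftForm; ring

lemma integrable_shiftForm_mul (a b : ℝ≥0) (s t q p₁ q₁ p₂ q₂ c : ℝ) :
    Integrable (fun w : ℝ × ℝ => shiftForm s t q (p₁ * w.1 + q₁ * w.2) (p₂ * w.1 + q₂ * w.2)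
      * (signPair w - c)) (gaussianPair a b) := by
  simp only [shiftForm_linear_eq]
  exact integrable_mul_signPair_sub a b
    ((((integrable_pow_mul_pow_gaussianPair a b 2 0).const_mul _).add
    ((integrable_pow_mul_pow_gaussianPair a b 1 1).const_mul _)).add
    ((integrable_pow_mul_pow_gaussianPair a b 0 2).const_mul _)) c

lemma integral_shiftForm_mul (a b : ℝ≥0) (s t q p₁ q₁ p₂ q₂ : ℝ) :
    ∫ w, shiftForm s t q (p₁ * w.1 + q₁ * w.2) (p₂ * w.1 + q₂ * w.2)
        * (signPair w - ∫ z, signPair z ∂(gaussianPair a b)) ∂(gaussianPair a b)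
      = shiftForm s t q p₁ p₂ * signPairMoment a b 2 0
        + (shiftForm s t q (p₁ + q₁) (p₂ + q₂) - shiftForm s t q p₁ p₂ - shiftForm s t q q₁ q₂)
          * signPairMoment a b 1 1
        + shiftForm s t q q₁ q₂ * signPairMoment a b 0 2 := by
  set c := ∫ z, signPair z ∂(gaussianPair a b) with hc
  simp only [shiftForm_linear_eq, add_mul, mul_assoc (shiftForm s t q p₁ p₂),
    mul_assoc (shiftForm s t q q₁ q₂),
    mul_assoc (shiftForm s t q (p₁ + q₁) (p₂ + q₂) - shiftForm s t q p₁ p₂ - shiftForm s t q q₁ q₂)]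
  have i1 := (integrable_monomial_mul_signPair_sub a b 2 0 c).const_mul (shiftForm s t q p₁ p₂)
  have i2 := (integrable_monomial_mul_signPair_sub a b 1 1 c).const_mul
    (shiftForm s t q (p₁ + q₁) (p₂ + q₂) - shiftForm s t q p₁ p₂ - shiftForm s t q q₁ q₂)
  have i3 := (integrable_monomial_mul_signPair_sub a b 0 2 c).const_mul (shiftForm s t q q₁ q₂)
  rw [integral_add (i1.fun_add i2) i3, integral_add i1 i2, integral_const_mul, integral_const_mul,
    integral_const_mul]
  rfl

/-- Decoupling: if `Y₁ = X + p₁ U + q₁ V` and `Y₂ = Y + p₂ U + q₂ V` with `(X, Y)` independent of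
`(U, V)`, then conditioning on `(U, V)` turns the covariance of the sign products into an integral
of `meanSignMul`, whose expansion is supposed to be known. The constant term drops out against the
centred sign pair. -/
lemma abs_covariance_upSign_mul_signPair_sub_le {X Y U V : Ω → ℝ} {a b : ℝ≥0} {s t q K : ℝ}
    (hX : AEMeasurable X P) (hY : AEMeasurable Y P) (hU : AEMeasurable U P) (hV : AEMeasurable V P)
    (hind : IndepFun (fun ω => (U ω, V ω)) (fun ω => (X ω, Y ω)) P)
    (hlaw : P.map (fun ω => (U ω, V ω)) = gaussianPair a b) (hK : 0 ≤ K)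
    (hF : ∀ m n : ℝ, |meanSignMul P X Y m n - meanSignMul P X Y 0 0 - shiftForm s t q m n|
      ≤ K * (|m| + |n|) ^ 4) (p₁ q₁ p₂ q₂ : ℝ) :
    |cov[fun ω => upSign (X ω + (p₁ * U ω + q₁ * V ω)) * upSign (Y ω + (p₂ * U ω + q₂ * V ω)),
        fun ω => signPair (U ω, V ω); P]
      - ∫ w, shiftForm s t q (p₁ * w.1 + q₁ * w.2) (p₂ * w.1 + q₂ * w.2)
          * (signPair w - ∫ z, signPair z ∂(gaussianPair a b)) ∂(gaussianPair a b)|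
      ≤ 2 * K * (|p₁| + |q₁| + |p₂| + |q₂|) ^ 4 *
          ∫ w, (|w.1| + |w.2|) ^ 4 ∂(gaussianPair a b) := by
  set ν := gaussianPair a b with hν
  set c := ∫ z, signPair z ∂ν with hc
  set μ := P.map (fun ω => (X ω, Y ω)) with hμ
  have hXY : AEMeasurable (fun ω => (X ω, Y ω)) P := hX.prodMk hY
  have hUV : AEMeasurable (fun ω => (U ω, V ω)) P := hU.prodMk hV
  have : IsProbabilityMeasure μ := Measure.isProbabilityMeasure_map hXY
  have ms := measurable_upSign
  have mp := measurable_signPair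
  have hFmap : ∀ m n, meanSignMul P X Y m n = ∫ x, upSign (x.1 + m) * upSign (x.2 + n) ∂μ := by
    intro m n
    have hm : Measurable fun x : ℝ × ℝ => upSign (x.1 + m) * upSign (x.2 + n) := by fun_prop
    rw [hμ, integral_map hXY hm.aestronglyMeasurable, meanSignMul]
  have hFabs : ∀ m n, |meanSignMul P X Y m n| ≤ 1 := by
    intro m n
    have := norm_integral_le_of_norm_le_const (μ := P)
      (f := fun ω => upSign (X ω + m) * upSign (Y ω + n)) (C := 1)
      (ae_of_all _ fun ω => by rw [Real.norm_eq_abs, abs_mul, abs_upSign, abs_upSign, one_mul])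
    simpa [meanSignMul] using this
  set G : ℝ × ℝ → ℝ := fun w => meanSignMul P X Y (p₁ * w.1 + q₁ * w.2) (p₂ * w.1 + q₂ * w.2)
    with hG
  have hGm : StronglyMeasurable G := by
    have hm : Measurable fun z : (ℝ × ℝ) × (ℝ × ℝ) => upSign (z.2.1 + (p₁ * z.1.1 + q₁ * z.1.2))
        * upSign (z.2.2 + (p₂ * z.1.1 + q₂ * z.1.2)) := by fun_prop
    simp only [hG, hFmap]
    exact hm.stronglyMeasurable.integral_prod_right
  have hGi : Integrable G ν := integrable_of_abs_le_one hGm.aestronglyMeasurable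
    fun w => hFabs _ _
  have hgi : Integrable signPair ν :=
    integrable_of_abs_le_one mp.aestronglyMeasurable fun w => (abs_signPair w).le
  have hc1 : |c| ≤ 1 := by
    have := norm_integral_le_of_norm_le_const (μ := ν) (f := signPair) (C := 1)
      (ae_of_all _ fun w => (abs_signPair w).le)
    simpa using this
  have hgc : ∀ w, |signPair w - c| ≤ 2 := fun w =>
    (abs_sub _ _).trans (by rw [abs_signPair]; linarith)
  -- Conditioning on `(U, V)` turns the first factor into `G`.
  have hcov : cov[fun ω => upSign (X ω + (p₁ * U ω + q₁ * V ω))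
        * upSign (Y ω + (p₂ * U ω + q₂ * V ω)), fun ω => signPair (U ω, V ω); P]
      = ∫ w, G w * (signPair w - c) ∂ν := by
    set A : Ω → ℝ := fun ω => upSign (X ω + (p₁ * U ω + q₁ * V ω))
        * upSign (Y ω + (p₂ * U ω + q₂ * V ω)) with hA
    set B : Ω → ℝ := fun ω => signPair (U ω, V ω) with hB
    have hAm : AEStronglyMeasurable A P := by
      have h1 : AEMeasurable (fun ω => X ω + (p₁ * U ω + q₁ * V ω)) P := by fun_prop
      have h2 : AEMeasurable (fun ω => Y ω + (p₂ * U ω + q₂ * V ω)) P := by fun_prop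
      exact ((ms.comp_aemeasurable h1).mul (ms.comp_aemeasurable h2)).aestronglyMeasurable
    have hBm : AEStronglyMeasurable B P := (mp.comp_aemeasurable hUV).aestronglyMeasurable
    have hA1 : ∀ ω, |A ω| ≤ 1 := fun ω => by rw [hA]; simp [abs_mul, abs_upSign]
    have hB1 : ∀ ω, |B ω| ≤ 1 := fun ω => (abs_signPair _).le
    have hEB : ∫ ω, B ω ∂P = c := by
      rw [hc, ← hlaw, integral_map hUV mp.aestronglyMeasurable]
    rw [covariance_eq_sub (MemLp.of_bound hAm 1 (ae_of_all _ hA1))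
      (MemLp.of_bound hBm 1 (ae_of_all _ hB1)), hEB, ← integral_mul_const, ← integral_sub]
    · have hm : Measurable fun z : (ℝ × ℝ) × (ℝ × ℝ) =>
          upSign (z.2.1 + (p₁ * z.1.1 + q₁ * z.1.2)) * upSign (z.2.2 + (p₂ * z.1.1 + q₂ * z.1.2))
            * (signPair z.1 - c) := by fun_prop
      have h := integral_comp_of_indepFun hUV hXY hind hm ?_
      · rw [hlaw] at h
        simp only [integral_mul_const, ← hμ] at h
        simp only [hG, hFmap, ← h]
        refine integral_congr_ae (ae_of_all _ fun ω => ?_)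
        simp only [hA, hB, Pi.mul_apply]; ring
      · rw [hlaw]
        refine Integrable.of_bound hm.aestronglyMeasurable 2 (ae_of_all _ fun z => ?_)
        rw [Real.norm_eq_abs, abs_mul, abs_mul, abs_upSign, abs_upSign, one_mul, one_mul]
        exact hgc _
    · exact integrable_of_abs_le_one (hAm.mul hBm) fun ω => by
        rw [Pi.mul_apply, abs_mul]
        exact mul_le_one₀ (hA1 ω) (abs_nonneg _) (hB1 ω)
    · exact (integrable_of_abs_le_one hAm hA1).mul_const c
  have hconst : ∫ w, meanSignMul P X Y 0 0 * (signPair w - c) ∂ν = 0 := by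
    rw [integral_const_mul, integral_sub hgi (integrable_const _), ← hc]
    simp
  have hi1 : Integrable (fun w => G w * (signPair w - c)) ν :=
    integrable_mul_signPair_sub a b hGi c
  have hi2 : Integrable (fun w => meanSignMul P X Y 0 0 * (signPair w - c)) ν :=
    (hgi.sub (integrable_const _)).const_mul _
  have hi12 : Integrable (fun w => G w * (signPair w - c)
      - meanSignMul P X Y 0 0 * (signPair w - c)) ν := hi1.sub hi2
  have hi3 := integrable_shiftForm_mul a b s t q p₁ q₁ p₂ q₂ c
  rw [hcov, ← sub_zero (∫ w, G w * (signPair w - c) ∂ν), ← hconst, ← integral_sub hi1 hi2,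
    ← integral_sub hi12 hi3, ← integral_const_mul, ← Real.norm_eq_abs]
  refine norm_integral_le_of_norm_le
    ((integrable_abs_add_abs_pow_four_gaussianPair a b).const_mul _) (ae_of_all _ fun w => ?_)
  rw [← sub_mul, ← sub_mul, Real.norm_eq_abs, abs_mul]
  have hlin : |p₁ * w.1 + q₁ * w.2| + |p₂ * w.1 + q₂ * w.2|
      ≤ (|p₁| + |q₁| + |p₂| + |q₂|) * (|w.1| + |w.2|) := by
    have h1 := abs_add_le (p₁ * w.1) (q₁ * w.2)
    have h2 := abs_add_le (p₂ * w.1) (q₂ * w.2)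
    rw [abs_mul, abs_mul] at h1 h2
    nlinarith [abs_nonneg p₁, abs_nonneg q₁, abs_nonneg p₂, abs_nonneg q₂, abs_nonneg w.1,
      abs_nonneg w.2, mul_nonneg (abs_nonneg p₁) (abs_nonneg w.2),
      mul_nonneg (abs_nonneg p₂) (abs_nonneg w.2), mul_nonneg (abs_nonneg q₁) (abs_nonneg w.1),
      mul_nonneg (abs_nonneg q₂) (abs_nonneg w.1)]
  calc _ ≤ K * (|p₁ * w.1 + q₁ * w.2| + |p₂ * w.1 + q₂ * w.2|) ^ 4 * 2 :=
        mul_le_mul (hF _ _) (hgc w) (abs_nonneg _) (by positivity)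
    _ ≤ K * ((|p₁| + |q₁| + |p₂| + |q₂|) * (|w.1| + |w.2|)) ^ 4 * 2 := by gcongr
    _ = _ := by ring

end Decoupling

/-! ### Two weakly correlated Gaussian pairs -/

section LinearCombinations

variable {Ω ι : Type*} [Fintype ι] [MeasurableSpace Ω] {P : Measure Ω}
  {Y : ι → Ω → ℝ}

lemma hasGaussianLaw_sum_mul_prodMk (hY : HasGaussianLaw (fun ω i => Y i ω) P)
    (x₁ x₂ y₁ y₂ : ι → ℝ) :
    HasGaussianLaw (fun ω => ((∑ i, x₁ i * Y i ω, ∑ i, x₂ i * Y i ω),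
      (∑ i, y₁ i * Y i ω, ∑ i, y₂ i * Y i ω))) P := by
  let l : (ι → ℝ) → (ι → ℝ) →L[ℝ] ℝ := fun x => ∑ i, x i • ContinuousLinearMap.proj i
  have h := hY.map_fun (((l x₁).prod (l x₂)).prod ((l y₁).prod (l y₂)))
  simpa [l, sum_apply] using h

variable [IsProbabilityMeasure P]

lemma covariance_sum_mul_sum_mul (hY : ∀ i, MemLp (Y i) 2 P) (x y : ι → ℝ) :
    cov[fun ω => ∑ i, x i * Y i ω, fun ω => ∑ i, y i * Y i ω; P]
      = ∑ i, ∑ j, x i * y j * cov[Y i, Y j; P] := by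
  rw [covariance_fun_sum_fun_sum (fun i => (hY i).const_mul (x i))
    (fun i => (hY i).const_mul (y i))]
  simp_rw [covariance_const_mul_left, covariance_const_mul_right, mul_assoc]

lemma indepFun_prodMk_of_covariance_eq_zero {U V X Z : Ω → ℝ}
    (h : HasGaussianLaw (fun ω => ((U ω, V ω), (X ω, Z ω))) P)
    (h₁ : cov[U, X; P] = 0) (h₂ : cov[U, Z; P] = 0) (h₃ : cov[V, X; P] = 0)
    (h₄ : cov[V, Z; P] = 0) :
    IndepFun (fun ω => (U ω, V ω)) (fun ω => (X ω, Z ω)) P := by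
  have hU := h.fst.fst.memLp_two
  have hV := h.fst.snd.memLp_two
  have hX := h.snd.fst.memLp_two
  have hZ := h.snd.snd.memLp_two
  refine h.indepFun_of_covariance_strongDual fun L₁ L₂ => ?_
  have hL : ∀ (L : StrongDual ℝ (ℝ × ℝ)) (x y : ℝ), L (x, y) = L (1, 0) * x + L (0, 1) * y := by
    intro L x y
    have : ((x, y) : ℝ × ℝ) = x • (1, 0) + y • (0, 1) := by simp
    rw [this, map_add, map_smul, map_smul, smul_eq_mul, smul_eq_mul]; ring
  have e₁ : (L₁ ∘ fun ω => (U ω, V ω))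
      = (fun ω => L₁ (1, 0) * U ω) + fun ω => L₁ (0, 1) * V ω := by
    ext ω; simp [hL L₁ (U ω)]
  have e₂ : (L₂ ∘ fun ω => (X ω, Z ω))
      = (fun ω => L₂ (1, 0) * X ω) + fun ω => L₂ (0, 1) * Z ω := by
    ext ω; simp [hL L₂ (X ω)]
  rw [e₁, e₂, covariance_add_left (hU.const_mul _) (hV.const_mul _)
    ((hX.const_mul _).add (hZ.const_mul _)),
    covariance_add_right (hU.const_mul _) (hX.const_mul _) (hZ.const_mul _),
    covariance_add_right (hV.const_mul _) (hX.const_mul _) (hZ.const_mul _)]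
  simp only [covariance_const_mul_left, covariance_const_mul_right, h₁, h₂, h₃, h₄]
  simp

lemma map_prodMk_eq_gaussianPair {U V : Ω → ℝ} {a b : ℝ}
    (h : HasGaussianLaw (fun ω => (U ω, V ω)) P) (hU0 : ∫ ω, U ω ∂P = 0) (hV0 : ∫ ω, V ω ∂P = 0)
    (hU : Var[U; P] = a) (hV : Var[V; P] = b) (hUV : cov[U, V; P] = 0) :
    P.map (fun ω => (U ω, V ω)) = gaussianPair a.toNNReal b.toNNReal := by
  rw [(indepFun_iff_map_prod_eq_prod_map_map h.fst.aemeasurable h.snd.aemeasurable).1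
    (h.indepFun_of_covariance_eq_zero hUV), h.fst.map_eq_gaussianReal, h.snd.map_eq_gaussianReal,
    hU0, hV0, hU, hV, gaussianPair]

end LinearCombinations

section TwoPairs

/-- Covariance matrix of two pairs of standardized variables, both with correlation `r`; the first
variable has covariances `c₁ c₂` with the second pair, the second variable has `c₃ c₄`. -/
def pairCov (r c₁ c₂ c₃ c₄ : ℝ) : Matrix (Fin 4) (Fin 4) ℝ :=
  !![1, r, c₁, c₂; r, 1, c₃, c₄; c₁, c₃, 1, r; c₂, c₄, r, 1]

/-- Regression coefficient, on the sum of the second pair, of a variable with covariances `c` and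
`d` with that pair; the sum has variance `2 (1 + r)`. -/
noncomputable def sumCoeff (r c d : ℝ) : ℝ := (c + d) / (2 * (1 + r))

/-- Regression coefficient, on the difference of the second pair, of a variable with covariances `c`
and `d` with that pair; the difference has variance `2 (1 - r)`. -/
noncomputable def diffCoeff (r c d : ℝ) : ℝ := (c - d) / (2 * (1 - r))

/-- Covariance of the residuals of two variables of covariance `x` whose cross covariances with the
second pair are `(c, d)` and `(c', d')`. -/
noncomputable def residualCov (r x c d c' d' : ℝ) : ℝ :=
  x - 2 * (1 + r) * (sumCoeff r c d * sumCoeff r c' d')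
    - 2 * (1 - r) * (diffCoeff r c d * diffCoeff r c' d')

/-- The value of `shiftForm` at the residual covariances, integrated against the centred sign
pair: the second-order approximation of the covariance of the two sign products. -/
noncomputable def secondOrderTerm (r c₁ c₂ c₃ c₄ : ℝ) : ℝ :=
  let Q := shiftForm (residualCov r 1 c₁ c₂ c₁ c₂) (residualCov r 1 c₃ c₄ c₃ c₄)
    (residualCov r r c₁ c₂ c₃ c₄)
  let a := (2 * (1 + r)).toNNReal
  let b := (2 * (1 - r)).toNNReal
  let p₁ := sumCoeff r c₁ c₂
  let q₁ := diffCoeff r c₁ c₂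
  let p₂ := sumCoeff r c₃ c₄
  let q₂ := diffCoeff r c₃ c₄
  Q p₁ p₂ * signPairMoment a b 2 0
    + (Q (p₁ + q₁) (p₂ + q₂) - Q p₁ p₂ - Q q₁ q₂) * signPairMoment a b 1 1
    + Q q₁ q₂ * signPairMoment a b 0 2

/-- The determinant of the residual covariance matrix. -/
noncomputable def residualDet (r c₁ c₂ c₃ c₄ : ℝ) : ℝ :=
  residualCov r 1 c₁ c₂ c₁ c₂ * residualCov r 1 c₃ c₄ c₃ c₄ - residualCov r r c₁ c₂ c₃ c₄ ^ 2

variable {Ω : Type*} [MeasurableSpace Ω] {P : Measure Ω} [IsProbabilityMeasure P]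

/-- Regressing the first pair on the sum and the difference of the second, which are independent,
reduces the covariance of the two sign products to the decoupled situation. -/
lemma abs_covariance_upSign_mul_upSign_sub_le {Y : Fin 4 → Ω → ℝ} {r c₁ c₂ c₃ c₄ δ : ℝ}
    (hY : HasGaussianLaw (fun ω i => Y i ω) P) (hY0 : ∀ i, ∫ ω, Y i ω ∂P = 0)
    (hcov : ∀ i j, cov[Y i, Y j; P] = pairCov r c₁ c₂ c₃ c₄ i j) (hr : |r| < 1)
    (hδ : 0 < δ) (hD : δ ≤ residualDet r c₁ c₂ c₃ c₄) :
    |cov[fun ω => upSign (Y 0 ω) * upSign (Y 1 ω), fun ω => upSign (Y 2 ω) * upSign (Y 3 ω); P]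
        - secondOrderTerm r c₁ c₂ c₃ c₄|
      ≤ 2 * (2 * expansionConst δ)
        * (|sumCoeff r c₁ c₂| + |diffCoeff r c₁ c₂| + |sumCoeff r c₃ c₄| + |diffCoeff r c₃ c₄|) ^ 4
        * ∫ w, (|w.1| + |w.2|) ^ 4
            ∂(gaussianPair (2 * (1 + r)).toNNReal (2 * (1 - r)).toNNReal) := by
  obtain ⟨hr1, hr2⟩ := abs_lt.1 hr
  have hp : 1 + r ≠ 0 := by linarith
  have hm : 1 - r ≠ 0 := by linarith
  set p₁ := sumCoeff r c₁ c₂ with hp₁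
  set q₁ := diffCoeff r c₁ c₂ with hq₁
  set p₂ := sumCoeff r c₃ c₄ with hp₂
  set q₂ := diffCoeff r c₃ c₄ with hq₂
  have e₁ : c₁ = (1 + r) * p₁ + (1 - r) * q₁ := by
    rw [hp₁, hq₁, sumCoeff, diffCoeff]; field_simp; ring
  have e₂ : c₂ = (1 + r) * p₁ - (1 - r) * q₁ := by
    rw [hp₁, hq₁, sumCoeff, diffCoeff]; field_simp; ring
  have e₃ : c₃ = (1 + r) * p₂ + (1 - r) * q₂ := by
    rw [hp₂, hq₂, sumCoeff, diffCoeff]; field_simp; ring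
  have e₄ : c₄ = (1 + r) * p₂ - (1 - r) * q₂ := by
    rw [hp₂, hq₂, sumCoeff, diffCoeff]; field_simp; ring
  let xU : Fin 4 → ℝ := ![0, 0, 1, 1]
  let xV : Fin 4 → ℝ := ![0, 0, 1, -1]
  let xN : Fin 4 → ℝ := ![1, 0, -(p₁ + q₁), -(p₁ - q₁)]
  let xM : Fin 4 → ℝ := ![0, 1, -(p₂ + q₂), -(p₂ - q₂)]
  let lin : (Fin 4 → ℝ) → Ω → ℝ := fun x ω => ∑ i, x i * Y i ω
  have hYm : ∀ i, MemLp (Y i) 2 P := fun i => (hY.eval i).memLp_two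
  have hlin0 : ∀ x, ∫ ω, lin x ω ∂P = 0 := by
    intro x
    simp only [lin]
    rw [integral_finsetSum _ fun i _ => (hY.eval i).integrable.const_mul _]
    simp [integral_const_mul, hY0]
  have hc : ∀ x y, cov[lin x, lin y; P] = ∑ i, ∑ j, x i * y j * pairCov r c₁ c₂ c₃ c₄ i j := by
    intro x y
    simp only [lin, covariance_sum_mul_sum_mul hYm, hcov]
  have hg := hasGaussianLaw_sum_mul_prodMk hY xU xV xN xM
  have cUN : cov[lin xU, lin xN; P] = 0 := by
    rw [hc]; simp [xU, xN, Fin.sum_univ_four, pairCov, e₁, e₂]; ring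
  have cUM : cov[lin xU, lin xM; P] = 0 := by
    rw [hc]; simp [xU, xM, Fin.sum_univ_four, pairCov, e₃, e₄]; ring
  have cVN : cov[lin xV, lin xN; P] = 0 := by
    rw [hc]; simp [xV, xN, Fin.sum_univ_four, pairCov, e₁, e₂]; ring
  have cVM : cov[lin xV, lin xM; P] = 0 := by
    rw [hc]; simp [xV, xM, Fin.sum_univ_four, pairCov, e₃, e₄]; ring
  have cUV : cov[lin xU, lin xV; P] = 0 := by
    rw [hc]; simp [xU, xV, Fin.sum_univ_four, pairCov]
  have vU : Var[lin xU; P] = 2 * (1 + r) := by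
    rw [← covariance_self hg.fst.fst.aemeasurable, hc]
    simp [xU, Fin.sum_univ_four, pairCov]; ring
  have vV : Var[lin xV; P] = 2 * (1 - r) := by
    rw [← covariance_self hg.fst.snd.aemeasurable, hc]
    simp [xV, Fin.sum_univ_four, pairCov]; ring
  have vN : Var[lin xN; P] = residualCov r 1 c₁ c₂ c₁ c₂ := by
    rw [← covariance_self hg.snd.fst.aemeasurable, hc, residualCov, ← hp₁, ← hq₁]
    simp [xN, Fin.sum_univ_four, pairCov, e₁, e₂]; ring
  have vM : Var[lin xM; P] = residualCov r 1 c₃ c₄ c₃ c₄ := by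
    rw [← covariance_self hg.snd.snd.aemeasurable, hc, residualCov, ← hp₂, ← hq₂]
    simp [xM, Fin.sum_univ_four, pairCov, e₃, e₄]; ring
  have cNM : cov[lin xN, lin xM; P] = residualCov r r c₁ c₂ c₃ c₄ := by
    rw [hc, residualCov, ← hp₂, ← hq₂, ← hp₁, ← hq₁]
    simp [xN, xM, Fin.sum_univ_four, pairCov, e₁, e₂, e₃, e₄]; ring
  have hle : ∀ c d, residualCov r 1 c d c d ≤ 1 := by
    intro c d
    unfold residualCov
    nlinarith [mul_self_nonneg (sumCoeff r c d), mul_self_nonneg (diffCoeff r c d)]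
  have hF := abs_meanSignMul_sub_le hg.snd (hlin0 xN) (hlin0 xM) vN vM cNM (hle _ _) (hle _ _) hδ hD
  have hlaw := map_prodMk_eq_gaussianPair hg.fst (hlin0 xU) (hlin0 xV) vU vV cUV
  have hind := indepFun_prodMk_of_covariance_eq_zero hg cUN cUM cVN cVM
  have key := abs_covariance_upSign_mul_signPair_sub_le hg.snd.fst.aemeasurable
    hg.snd.snd.aemeasurable hg.fst.fst.aemeasurable hg.fst.snd.aemeasurable hind hlaw
    (mul_nonneg zero_le_two (expansionConst_nonneg hδ)) hF p₁ q₁ p₂ q₂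
  rw [integral_shiftForm_mul] at key
  have f₁ : (fun ω => upSign (lin xN ω + (p₁ * lin xU ω + q₁ * lin xV ω))
      * upSign (lin xM ω + (p₂ * lin xU ω + q₂ * lin xV ω)))
      = fun ω => upSign (Y 0 ω) * upSign (Y 1 ω) := by
    ext ω
    congr 2 <;> simp [lin, xU, xV, xN, xM, Fin.sum_univ_four] <;> ring
  have f₂ : (fun ω => signPair (lin xU ω, lin xV ω))
      = fun ω => upSign (Y 2 ω) * upSign (Y 3 ω) := by
    ext ω
    rw [signPair, ← upSign_mul_pos zero_lt_two (Y 2 ω), ← upSign_mul_pos zero_lt_two (Y 3 ω)]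
    congr 2 <;> simp [lin, xU, xV, Fin.sum_univ_four] <;> ring
  rw [← f₁, ← f₂]
  exact key

/-- Vanishing cross covariances mean independent pairs. -/
lemma covariance_upSign_mul_upSign_eq_zero {Y : Fin 4 → Ω → ℝ} {r : ℝ}
    (hY : HasGaussianLaw (fun ω i => Y i ω) P) (hY0 : ∀ i, ∫ ω, Y i ω ∂P = 0)
    (hcov : ∀ i j, cov[Y i, Y j; P] = pairCov r 0 0 0 0 i j) (hr : |r| < 1) :
    cov[fun ω => upSign (Y 0 ω) * upSign (Y 1 ω), fun ω => upSign (Y 2 ω) * upSign (Y 3 ω); P]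
      = 0 := by
  have h1 : 0 < 1 - r ^ 2 := by
    have := (sq_lt_one_iff_abs_lt_one r).2 hr
    linarith
  have h := abs_covariance_upSign_mul_upSign_sub_le hY hY0 hcov hr h1
    (by simp [residualDet, residualCov, sumCoeff, diffCoeff])
  simpa [secondOrderTerm, sumCoeff, diffCoeff, shiftForm] using h

lemma shiftForm_div (s t q m n ε : ℝ) :
    shiftForm s t q m n / ε ^ 2 = shiftForm s t q (m / ε) (n / ε) := by
  unfold shiftForm
  ring

lemma tendsto_shiftForm {s t q m n : ℕ → ℝ} {q₀ m₀ n₀ : ℝ} (hq₀ : |q₀| < 1)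
    (hs : Tendsto s atTop (nhds 1)) (ht : Tendsto t atTop (nhds 1))
    (hq : Tendsto q atTop (nhds q₀)) (hm : Tendsto m atTop (nhds m₀))
    (hn : Tendsto n atTop (nhds n₀)) :
    Tendsto (fun k => shiftForm (s k) (t k) (q k) (m k) (n k)) atTop
      (nhds (shiftForm 1 1 q₀ m₀ n₀)) := by
  have h1 : 0 < 1 - q₀ ^ 2 := by
    have := (sq_lt_one_iff_abs_lt_one q₀).2 hq₀
    linarith
  unfold shiftForm
  refine (tendsto_const_nhds.div
    (tendsto_const_nhds.mul (((hs.mul ht).sub (hq.pow 2)).sqrt)) ?_).mul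
    (((hm.mul hn).sub (((hq.div hs one_ne_zero).mul (hm.pow 2)).div_const 2)).sub
      (((hq.div ht one_ne_zero).mul (hn.pow 2)).div_const 2))
  rw [one_mul]
  have := Real.pi_pos
  positivity

/-- If the four cross covariances of two standardized Gaussian pairs are all asymptotic to `L ε`,
then the covariance of the sign products is of order `ε ^ 2`, with an explicit constant. -/
lemma tendsto_covariance_upSign_mul_upSign {Y : ℕ → Fin 4 → Ω → ℝ} {r L : ℝ}
    {c₁ c₂ c₃ c₄ ε : ℕ → ℝ}
    (hY : ∀ᶠ k in atTop, HasGaussianLaw (fun ω i => Y k i ω) P)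
    (hY0 : ∀ᶠ k in atTop, ∀ i, ∫ ω, Y k i ω ∂P = 0)
    (hcov : ∀ᶠ k in atTop, ∀ i j, cov[Y k i, Y k j; P]
      = pairCov r (c₁ k) (c₂ k) (c₃ k) (c₄ k) i j)
    (hr : |r| < 1) (hε0 : ∀ᶠ k in atTop, ε k ≠ 0) (hε : Tendsto ε atTop (nhds 0))
    (h₁ : Tendsto (fun k => c₁ k / ε k) atTop (nhds L))
    (h₂ : Tendsto (fun k => c₂ k / ε k) atTop (nhds L))
    (h₃ : Tendsto (fun k => c₃ k / ε k) atTop (nhds L))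
    (h₄ : Tendsto (fun k => c₄ k / ε k) atTop (nhds L)) :
    Tendsto (fun k => cov[fun ω => upSign (Y k 0 ω) * upSign (Y k 1 ω),
        fun ω => upSign (Y k 2 ω) * upSign (Y k 3 ω); P] / ε k ^ 2) atTop
      (nhds (8 * (1 - r) / (Real.pi ^ 2 * (1 + r)) * L ^ 2)) := by
  obtain ⟨hr1, hr2⟩ := abs_lt.1 hr
  have hp : 1 + r ≠ 0 := by linarith
  have hm : 1 - r ≠ 0 := by linarith
  have h1r : 0 < 1 - r ^ 2 := by nlinarith
  have hsum : ∀ {c d : ℕ → ℝ}, Tendsto (fun k => c k / ε k) atTop (nhds L) →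
      Tendsto (fun k => d k / ε k) atTop (nhds L) →
      Tendsto (fun k => sumCoeff r (c k) (d k) / ε k) atTop (nhds (L / (1 + r))) := by
    intro c d hc hd
    have h := (hc.add hd).div_const (2 * (1 + r))
    have e : (L + L) / (2 * (1 + r)) = L / (1 + r) := by field_simp; ring
    rw [e] at h
    refine h.congr fun k => ?_
    unfold sumCoeff; ring
  have hdiff : ∀ {c d : ℕ → ℝ}, Tendsto (fun k => c k / ε k) atTop (nhds L) →
      Tendsto (fun k => d k / ε k) atTop (nhds L) →
      Tendsto (fun k => diffCoeff r (c k) (d k) / ε k) atTop (nhds 0) := by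
    intro c d hc hd
    have h := (hc.sub hd).div_const (2 * (1 - r))
    rw [sub_self, zero_div] at h
    refine h.congr fun k => ?_
    unfold diffCoeff; ring
  have hzero : ∀ {c : ℕ → ℝ} {l : ℝ}, Tendsto (fun k => c k / ε k) atTop (nhds l) →
      Tendsto c atTop (nhds 0) := by
    intro c l hc
    have h := hc.mul hε
    rw [mul_zero] at h
    refine h.congr' ?_
    filter_upwards [hε0] with k hk
    field_simp
  have hres : ∀ {c d c' d' : ℕ → ℝ} (x : ℝ), Tendsto (fun k => c k / ε k) atTop (nhds L) →
      Tendsto (fun k => d k / ε k) atTop (nhds L) → Tendsto (fun k => c' k / ε k) atTop (nhds L) →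
      Tendsto (fun k => d' k / ε k) atTop (nhds L) →
      Tendsto (fun k => residualCov r x (c k) (d k) (c' k) (d' k)) atTop (nhds x) := by
    intro c d c' d' x hc hd hc' hd'
    have h := (tendsto_const_nhds (x := x)).sub
      (((hzero (hsum hc hd)).mul (hzero (hsum hc' hd'))).const_mul (2 * (1 + r))) |>.sub
      (((hzero (hdiff hc hd)).mul (hzero (hdiff hc' hd'))).const_mul (2 * (1 - r)))
    simpa [residualCov] using h
  have hs := hres 1 h₁ h₂ h₁ h₂
  have ht := hres 1 h₃ h₄ h₃ h₄
  have hq := hres r h₁ h₂ h₃ h₄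
  have hdet : Tendsto (fun k => residualDet r (c₁ k) (c₂ k) (c₃ k) (c₄ k)) atTop
      (nhds (1 - r ^ 2)) := by
    have := (hs.mul ht).sub (hq.pow 2)
    rwa [one_mul] at this
  set a := (2 * (1 + r)).toNNReal with ha
  set b := (2 * (1 - r)).toNNReal with hb
  -- The mixed and the difference terms vanish in the limit, since both `diffCoeff` are `o(ε)`.
  have hmain : Tendsto (fun k => secondOrderTerm r (c₁ k) (c₂ k) (c₃ k) (c₄ k) / ε k ^ 2) atTop
      (nhds (8 * (1 - r) / (Real.pi ^ 2 * (1 + r)) * L ^ 2)) := by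
    have hA := tendsto_shiftForm hr hs ht hq (hsum h₁ h₂) (hsum h₃ h₄)
    have hB := tendsto_shiftForm hr hs ht hq ((hsum h₁ h₂).add (hdiff h₁ h₂))
      ((hsum h₃ h₄).add (hdiff h₃ h₄))
    have hC := tendsto_shiftForm hr hs ht hq (hdiff h₁ h₂) (hdiff h₃ h₄)
    have h := ((hA.mul_const (signPairMoment a b 2 0)).add
      (((hB.sub hA).sub hC).mul_const (signPairMoment a b 1 1))).add
      (hC.mul_const (signPairMoment a b 0 2))
    replace h := h.congr fun k => show _ =
        secondOrderTerm r (c₁ k) (c₂ k) (c₃ k) (c₄ k) / ε k ^ 2 by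
      simp only [secondOrderTerm, ← shiftForm_div, ← add_div, ← ha, ← hb]; ring
    have e0 : shiftForm 1 1 r 0 0 = 0 := by simp [shiftForm]
    have e20 : signPairMoment a b 2 0
        = 4 * (2 * (1 + r)) * √(2 * (1 + r) * (2 * (1 - r))) / (Real.pi * 4) := by
      have hca : (a : ℝ) = 2 * (1 + r) := Real.coe_toNNReal _ (by linarith)
      have hcb : (b : ℝ) = 2 * (1 - r) := Real.coe_toNNReal _ (by linarith)
      have := integral_sq_mul_signPair_sub (a := a) (b := b)
        (Real.toNNReal_pos.2 (by linarith)).ne' (Real.toNNReal_pos.2 (by linarith)).ne'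
      rw [hca, hcb] at this
      simp only [signPairMoment, pow_zero, mul_one, this]
      congr 2; ring
    have hsq : √(2 * (1 + r) * (2 * (1 - r))) = 2 * √(1 - r ^ 2) := by
      rw [show 2 * (1 + r) * (2 * (1 - r)) = 2 ^ 2 * (1 - r ^ 2) by ring,
        Real.sqrt_mul (by positivity), Real.sqrt_sq (by positivity)]
    rw [e0, add_zero, sub_self, sub_zero, zero_mul, zero_mul, add_zero, add_zero, e20, hsq] at h
    have elim : shiftForm 1 1 r (L / (1 + r)) (L / (1 + r))
        * (4 * (2 * (1 + r)) * (2 * √(1 - r ^ 2)) / (Real.pi * 4))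
        = 8 * (1 - r) / (Real.pi ^ 2 * (1 + r)) * L ^ 2 := by
      have := Real.sqrt_pos.2 h1r
      have := Real.pi_pos
      unfold shiftForm
      rw [one_mul]
      field_simp
      ring
    rw [elim] at h
    exact h
  -- The remainder is of fourth order in `ε`, and `(1 - r ^ 2) / 2` bounds the residual determinant
  -- from below eventually.
  have hδ : 0 < (1 - r ^ 2) / 2 := by linarith
  set C := 2 * (2 * expansionConst ((1 - r ^ 2) / 2)) with hCdef
  set M := ∫ w, (|w.1| + |w.2|) ^ 4 ∂(gaussianPair a b) with hM
  have hrem : Tendsto (fun k => C * (|sumCoeff r (c₁ k) (c₂ k) / ε k|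
      + |diffCoeff r (c₁ k) (c₂ k) / ε k| + |sumCoeff r (c₃ k) (c₄ k) / ε k|
      + |diffCoeff r (c₃ k) (c₄ k) / ε k|) ^ 4 * M * ε k ^ 2) atTop (nhds 0) := by
    have h := ((((((hsum h₁ h₂).abs.add (hdiff h₁ h₂).abs).add (hsum h₃ h₄).abs).add
      (hdiff h₃ h₄).abs).pow 4).const_mul C).mul_const M |>.mul (hε.pow 2)
    simpa using h
  have hdiff0 : Tendsto (fun k => (cov[fun ω => upSign (Y k 0 ω) * upSign (Y k 1 ω),
        fun ω => upSign (Y k 2 ω) * upSign (Y k 3 ω); P]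
        - secondOrderTerm r (c₁ k) (c₂ k) (c₃ k) (c₄ k)) / ε k ^ 2) atTop (nhds 0) := by
    refine squeeze_zero_norm' ?_ hrem
    filter_upwards [hY, hY0, hcov, hε0,
      hdet.eventually_const_le (u := (1 - r ^ 2) / 2) (by linarith)]
      with k k1 k2 k3 k4 k5
    have h := abs_covariance_upSign_mul_upSign_sub_le k1 k2 k3 hr hδ k5
    rw [← ha, ← hb, ← hM, ← hCdef] at h
    clear_value C M
    rw [Real.norm_eq_abs, abs_div, abs_of_pos (by positivity : 0 < ε k ^ 2),
      div_le_iff₀ (by positivity)]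
    refine h.trans_eq ?_
    simp only [abs_div]
    rw [← add_div, ← add_div, ← add_div, div_pow, Even.pow_abs (by decide : Even 4)]
    field_simp
  have := hdiff0.add hmain
  rw [zero_add] at this
  refine this.congr fun k => ?_
  ring

end TwoPairs

/-! ### Fractional Gaussian noise -/

section FractionalGaussianNoise

/-- The autocovariance of fractional Gaussian noise at (real) lag `x`. -/
noncomputable def fgnCov (H x : ℝ) : ℝ :=
  1 / 2 * (|x + 1| ^ (2 * H) - 2 * |x| ^ (2 * H) + |x - 1| ^ (2 * H))

lemma fgnCov_neg (H x : ℝ) : fgnCov H (-x) = fgnCov H x := by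
  unfold fgnCov
  rw [show -x + 1 = -(x - 1) by ring, show -x - 1 = -(x + 1) by ring, abs_neg, abs_neg, abs_neg]
  ring

lemma fgnCov_zero {H : ℝ} (hH : 0 < H) : fgnCov H 0 = 1 := by
  simp [fgnCov, Real.zero_rpow (by positivity : 2 * H ≠ 0)]; norm_num

lemma fgnCov_one {H : ℝ} (hH : 0 < H) : fgnCov H 1 = 1 / 2 * 2 ^ (2 * H) - 1 := by
  simp only [fgnCov, sub_self, abs_zero, Real.zero_rpow (by positivity : 2 * H ≠ 0), abs_one,
    Real.one_rpow]
  norm_num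
  ring

lemma abs_fgnCov_one_lt {H : ℝ} (hH : 0 < H) (hH1 : H < 1) : |fgnCov H 1| < 1 := by
  have h1 : (2 : ℝ) ^ (2 * H) < 2 ^ (2 : ℝ) := Real.rpow_lt_rpow_of_exponent_lt (by norm_num)
    (by linarith)
  have h2 : (0 : ℝ) < 2 ^ (2 * H) := by positivity
  norm_num at h1
  rw [fgnCov_one hH, abs_lt]
  constructor <;> linarith

/-- For `H = 1 / 2` the formula is a second difference of `|x|`, which vanishes away from `0`. -/
lemma fgnCov_half {x : ℝ} (hx : 1 ≤ x) : fgnCov (1 / 2) x = 0 := by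
  rw [fgnCov, abs_of_nonneg (by linarith), abs_of_nonneg (by linarith), abs_of_nonneg (by linarith)]
  norm_num
  ring

lemma fgnCov_one_left (x : ℝ) : fgnCov 1 x = 1 := by
  simp only [fgnCov, mul_one, Real.rpow_two, sq_abs]
  ring

/-- The second symmetric difference quotient of `(1 + y) ^ p` at `0`. -/
lemma tendsto_rpow_symm_diff (p : ℝ) :
    Tendsto (fun y : ℝ => ((1 + y) ^ p + (1 - y) ^ p - 2) / y ^ 2) (nhdsWithin 0 {0}ᶜ)
      (nhds (p * (p - 1))) := by
  have hadd : ∀ (s y : ℝ), -1 < y →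
      HasDerivAt (fun y : ℝ => (1 + y) ^ s) (s * (1 + y) ^ (s - 1)) y := by
    intro s y hy
    have := ((hasDerivAt_id y).const_add 1).rpow_const (p := s) (Or.inl (by simp; linarith))
    refine this.congr_deriv ?_
    simp
  have hsub : ∀ (s y : ℝ), y < 1 →
      HasDerivAt (fun y : ℝ => (1 - y) ^ s) (-(s * (1 - y) ^ (s - 1))) y := by
    intro s y hy
    have := ((hasDerivAt_id y).const_sub 1).rpow_const (p := s) (Or.inl (by simp; linarith))
    refine this.congr_deriv ?_
    simp
  have hnear : ∀ᶠ y : ℝ in nhdsWithin 0 {0}ᶜ, -1 < y ∧ y < 1 :=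
    eventually_nhdsWithin_of_eventually_nhds
      (Ioo_mem_nhds (by norm_num : (-1 : ℝ) < 0) (by norm_num : (0 : ℝ) < 1))
  have hder : ∀ (s y : ℝ), -1 < y → y < 1 → HasDerivAt (fun y : ℝ => (1 + y) ^ s + (1 - y) ^ s - 2)
      (s * (1 + y) ^ (s - 1) - s * (1 - y) ^ (s - 1)) y := by
    intro s y h1 h2
    have := ((hadd s y h1).add (hsub s y h2)).sub_const 2
    refine this.congr_deriv ?_
    ring
  refine HasDerivAt.lhopital_zero_nhdsNE
    (f' := fun y => p * (1 + y) ^ (p - 1) - p * (1 - y) ^ (p - 1)) (g' := fun y => 2 * y)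
    ?_ ?_ ?_ ?_ ?_ ?_
  · filter_upwards [hnear] with y hy using hder p y hy.1 hy.2
  · refine Eventually.of_forall fun y => ?_
    simpa using hasDerivAt_pow 2 y
  · filter_upwards [self_mem_nhdsWithin] with y hy
    simpa using hy
  · have := (hder p 0 (by norm_num) (by norm_num)).continuousAt.tendsto
    norm_num at this
    exact this.mono_left nhdsWithin_le_nhds
  · have : Tendsto (fun y : ℝ => y ^ 2) (nhds 0) (nhds (0 ^ 2)) := (continuous_pow 2).tendsto 0
    norm_num at this
    exact this.mono_left nhdsWithin_le_nhds
  · have h := ((hadd (p - 1) 0 (by norm_num)).sub (hsub (p - 1) 0 (by norm_num))).const_mul (p / 2)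
    rw [hasDerivAt_iff_tendsto_slope_zero] at h
    simp only [add_zero, sub_zero, Real.one_rpow, mul_one, zero_add, smul_eq_mul, Pi.sub_apply,
      sub_self, mul_zero] at h
    have e : p / 2 * (p - 1 - -(p - 1)) = p * (p - 1) := by ring
    rw [e] at h
    refine h.congr' ?_
    filter_upwards [self_mem_nhdsWithin] with y hy
    have hy' : y ≠ 0 := hy
    field_simp

lemma tendsto_fgnCov_div (H : ℝ) :
    Tendsto (fun x : ℝ => fgnCov H x / x ^ (2 * H - 2)) atTop (nhds (H * (2 * H - 1))) := by
  have hinv : Tendsto (fun x : ℝ => x⁻¹) atTop (nhdsWithin 0 {0}ᶜ) :=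
    tendsto_inv_atTop_nhdsGT_zero.mono_right
      (nhdsWithin_mono _ fun x (hx : 0 < x) => hx.ne')
  have h := ((tendsto_rpow_symm_diff (2 * H)).comp hinv).const_mul (1 / 2)
  rw [show 1 / 2 * (2 * H * (2 * H - 1)) = H * (2 * H - 1) by ring] at h
  refine h.congr' ?_
  filter_upwards [eventually_gt_atTop 1] with x hx
  have hx0 : 0 < x := by linarith
  have hxi : x⁻¹ < 1 := inv_lt_one_of_one_lt₀ hx
  have e1 : (x + 1) ^ (2 * H) = x ^ (2 * H) * (1 + x⁻¹) ^ (2 * H) := by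
    rw [← Real.mul_rpow hx0.le (by positivity), mul_add, mul_one, mul_inv_cancel₀ hx0.ne']
  have e2 : (x - 1) ^ (2 * H) = x ^ (2 * H) * (1 - x⁻¹) ^ (2 * H) := by
    rw [← Real.mul_rpow hx0.le (by linarith), mul_sub, mul_one, mul_inv_cancel₀ hx0.ne']
  have e3 : x ^ (2 * H - 2) = x ^ (2 * H) / x ^ 2 := by
    rw [Real.rpow_sub hx0, Real.rpow_two]
  have hpos : 0 < x ^ (2 * H) := Real.rpow_pos_of_pos hx0 _
  rw [fgnCov, abs_of_pos (by linarith), abs_of_pos hx0, abs_of_pos (by linarith), e1, e2, e3]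
  simp only [Function.comp_apply]
  field_simp
  ring

/-- A shift of the lag by a constant does not change the leading behaviour. -/
lemma tendsto_fgnCov_add_div (H j : ℝ) :
    Tendsto (fun k : ℕ => fgnCov H (k + j) / (k : ℝ) ^ (2 * H - 2)) atTop
      (nhds (H * (2 * H - 1))) := by
  have hk : Tendsto (fun k : ℕ => (k : ℝ)) atTop atTop := tendsto_natCast_atTop_atTop
  have hkj : Tendsto (fun k : ℕ => (k : ℝ) + j) atTop atTop := tendsto_atTop_add_const_right _ _ hk
  have h1 := (tendsto_fgnCov_div H).comp hkj
  have h2 : Tendsto (fun k : ℕ => (1 + j * (k : ℝ)⁻¹) ^ (2 * H - 2)) atTop (nhds 1) := by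
    have h3 : Tendsto (fun k : ℕ => 1 + j * (k : ℝ)⁻¹) atTop (nhds 1) := by
      simpa using ((tendsto_inv_atTop_zero.comp hk).const_mul j).const_add 1
    have := h3.rpow_const (p := 2 * H - 2) (Or.inl one_ne_zero)
    rwa [Real.one_rpow] at this
  have h4 := h1.mul h2
  rw [mul_one] at h4
  refine h4.congr' ?_
  filter_upwards [hkj.eventually_gt_atTop 0, hk.eventually_gt_atTop 0] with k hk1 hk2
  have e : 1 + j * (k : ℝ)⁻¹ = (k + j) / k := by field_simp
  have hpos : 0 < ((k : ℝ) + j) ^ (2 * H - 2) := Real.rpow_pos_of_pos hk1 _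
  rw [Function.comp_apply, e, Real.div_rpow hk1.le hk2.le]
  field_simp

/-- An exact identity: ties of consecutive values count as a downward move on both sides. -/
lemma changeIndicator_eq {Ω : Type*} (X : ℕ → Ω → ℝ) (k : ℕ) (ω : Ω) :
    changeIndicator X k ω
      = 1 / 2 - 1 / 2 * (upSign (increment X (k + 1) ω) * upSign (increment X (k + 2) ω)) := by
  have e : k + 2 - 1 = k + 1 := rfl
  simp only [changeIndicator, Set.indicator, Set.mem_ofPred_eq, upSign, increment, sub_pos, e,
    add_tsub_cancel_right, ge_iff_le]
  split_ifs <;> first | (norm_num; done) | (exfalso; grind)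

variable {Ω : Type*} [MeasurableSpace Ω] {P : Measure Ω} {H : ℝ} {B : ℝ≥0 → Ω → ℝ}

lemma integral_increment (hB : IsStandardFractionalBrownianMotion H B P) (n : ℕ) :
    ∫ ω, increment (discretization B) n ω ∂P = 0 := by
  have hi : ∀ t, Integrable (B t) P := fun t =>
    (hB.isGaussianProcess.hasGaussianLaw_eval t).integrable
  simp only [increment, discretization]
  rw [integral_sub (hi _) (hi _), hB.mean_zero, hB.mean_zero, sub_zero]

/-- The increments that determine the change indicators at times `0` and `k`. -/
noncomputable def incrementQuad (B : ℝ≥0 → Ω → ℝ) (k : ℕ) (i : Fin 4) : Ω → ℝ :=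
  increment (discretization B) ((![0, 1, k, k + 1] : Fin 4 → ℕ) i + 1)

lemma hasGaussianLaw_incrementQuad (hB : IsStandardFractionalBrownianMotion H B P) (k : ℕ) :
    HasGaussianLaw (fun ω i => incrementQuad B k i ω) P := by
  have h := hB.isGaussianProcess.hasGaussianLaw_increments (n := 5)
    (t := fun i => ((![0, 1, 2, k, k + 1, k + 2] : Fin 6 → ℕ) i : ℝ≥0))
  -- Of the five increments along `0, 1, 2, k, k + 1, k + 2`, the one from `2` to `k` is dropped.
  have h2 := h.map_fun (ContinuousLinearMap.pi fun i : Fin 4 =>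
    ContinuousLinearMap.proj ((![0, 1, 3, 4] : Fin 4 → Fin 5) i))
  refine h2.congr (ae_of_all _ fun ω => funext fun i => ?_)
  fin_cases i <;> rfl

variable [IsProbabilityMeasure P]

lemma changeAutocovariance_eq (hB : IsStandardFractionalBrownianMotion H B P) (k : ℕ) :
    changeAutocovariance B P k = 1 / 4 *
      cov[fun ω => upSign (increment (discretization B) 1 ω)
          * upSign (increment (discretization B) 2 ω),
        fun ω => upSign (increment (discretization B) (k + 1) ω)
          * upSign (increment (discretization B) (k + 2) ω); P] := by
  have hm : ∀ n, AEMeasurable (increment (discretization B) n) P := fun n =>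
    (hB.isGaussianProcess.aemeasurable _).sub (hB.isGaussianProcess.aemeasurable _)
  have hi : ∀ m n, Integrable (fun ω => 1 / 2 * (upSign (increment (discretization B) m ω)
      * upSign (increment (discretization B) n ω))) P := fun m n =>
    (integrable_of_abs_le_one ((measurable_upSign.comp_aemeasurable (hm m)).mul
      (measurable_upSign.comp_aemeasurable (hm n))).aestronglyMeasurable
      fun ω => by simp [abs_mul, abs_upSign]).const_mul _
  rw [changeAutocovariance, funext (changeIndicator_eq _ 0), funext (changeIndicator_eq _ k),
    covariance_const_sub_left (hi _ _), covariance_const_sub_right (hi _ _),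
    covariance_const_mul_left, covariance_const_mul_right]
  ring

lemma covariance_increment (hB : IsStandardFractionalBrownianMotion H B P) (m n : ℕ) :
    cov[increment (discretization B) (m + 1), increment (discretization B) (n + 1); P]
      = fgnCov H (n - m) := by
  have hi : ∀ t, MemLp (B t) 2 P := fun t =>
    (hB.isGaussianProcess.hasGaussianLaw_eval t).memLp_two
  have e : ∀ k : ℕ, increment (discretization B) (k + 1)
      = fun ω => B ((k + 1 : ℕ) : ℝ≥0) ω - B (k : ℝ≥0) ω := fun k => rfl
  rw [e, e, covariance_fun_sub_fun_sub (hi _) (hi _) (hi _) (hi _)]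
  simp only [hB.covariance_eq, hB.variance_one, NNReal.coe_natCast, Nat.cast_add, Nat.cast_one,
    NNReal.coe_add, NNReal.coe_one]
  rw [fgnCov, abs_sub_comm ((m : ℝ) + 1) (n + 1), abs_sub_comm ((m : ℝ) + 1) n,
    abs_sub_comm (m : ℝ) (n + 1), abs_sub_comm (m : ℝ) n,
    show (n : ℝ) + 1 - (m + 1) = n - m by ring, show (n : ℝ) - (m + 1) = n - m - 1 by ring,
    show (n : ℝ) + 1 - m = n - m + 1 by ring]
  ring

lemma incrementAutocovariance_one (hB : IsStandardFractionalBrownianMotion H B P) :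
    incrementAutocovariance B P 1 = fgnCov H 1 := by
  have := covariance_increment hB 0 1
  simpa [incrementAutocovariance] using this

lemma covariance_incrementQuad (hB : IsStandardFractionalBrownianMotion H B P) (k : ℕ)
    (i j : Fin 4) :
    cov[incrementQuad B k i, incrementQuad B k j; P]
      = pairCov (fgnCov H 1) (fgnCov H k) (fgnCov H (k + 1)) (fgnCov H (k + -1)) (fgnCov H k)
          i j := by
  rw [incrementQuad, incrementQuad, covariance_increment hB]
  have h0 := fgnCov_zero hB.hurst_pos
  have hn := fgnCov_neg H
  fin_cases i <;> fin_cases j <;>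
    simp [pairCov, h0, hn, ← sub_eq_add_neg]
  all_goals
    rw [← hn]
    congr 1
    ring

end FractionalGaussianNoise

/-! ### Asymptotics of the change autocovariance -/

section MainResult

variable {Ω : Type*} [MeasurableSpace Ω] {P : Measure Ω} [IsProbabilityMeasure P] {H : ℝ}
  {B : ℝ≥0 → Ω → ℝ}

lemma changeAutocovariance_eq_incrementQuad (hB : IsStandardFractionalBrownianMotion H B P)
    (k : ℕ) :
    changeAutocovariance B P k = 1 / 4 *
      cov[fun ω => upSign (incrementQuad B k 0 ω) * upSign (incrementQuad B k 1 ω),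
        fun ω => upSign (incrementQuad B k 2 ω) * upSign (incrementQuad B k 3 ω); P] :=
  changeAutocovariance_eq hB k

/-- For `H = 1` the path is a random straight line, so no change ever occurs. -/
lemma changeAutocovariance_of_hurst_one (hB : IsStandardFractionalBrownianMotion 1 B P) (k : ℕ) :
    changeAutocovariance B P k = 0 := by
  have hG := hasGaussianLaw_incrementQuad hB k
  have h0 := (hG.eval 0).memLp_two
  have h1 := (hG.eval 1).memLp_two
  have hv : Var[fun ω => incrementQuad B k 0 ω - incrementQuad B k 1 ω; P] = 0 := by
    have hm := (h0.sub h1).aemeasurable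
    rw [← covariance_self (X := fun ω => incrementQuad B k 0 ω - incrementQuad B k 1 ω) hm,
      covariance_fun_sub_fun_sub h0 h1 h0 h1]
    simp [covariance_incrementQuad hB, pairCov, fgnCov_one_left]
  have hae := ae_eq_integral_of_variance_eq_zero (h0.sub h1) hv
  have hmean : ∫ ω, (incrementQuad B k 0 ω - incrementQuad B k 1 ω) ∂P = 0 := by
    rw [integral_sub (hG.eval 0).integrable (hG.eval 1).integrable, incrementQuad, incrementQuad,
      integral_increment hB, integral_increment hB, sub_zero]
  have hone : (fun ω => upSign (incrementQuad B k 0 ω) * upSign (incrementQuad B k 1 ω))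
      =ᵐ[P] fun _ => 1 := by
    filter_upwards [hae] with ω hω
    have hω' : incrementQuad B k 0 ω - incrementQuad B k 1 ω = 0 := hω.trans hmean
    rw [sub_eq_zero.1 hω', ← abs_mul_abs_self, abs_upSign, one_mul]
  rw [changeAutocovariance_eq_incrementQuad hB, covariance, integral_congr_ae hone,
    integral_eq_zero_of_ae, mul_zero]
  filter_upwards [hone] with ω hω
  simp [hω]

/-- For `H = 1 / 2` the increments are independent. -/
lemma changeAutocovariance_of_hurst_half (hB : IsStandardFractionalBrownianMotion (1 / 2) B P)
    {k : ℕ} (hk : 2 ≤ k) : changeAutocovariance B P k = 0 := by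
  have hk' : (2 : ℝ) ≤ k := by exact_mod_cast hk
  rw [changeAutocovariance_eq_incrementQuad hB, covariance_upSign_mul_upSign_eq_zero
    (r := fgnCov (1 / 2) 1) (hasGaussianLaw_incrementQuad hB k)
    (fun i => integral_increment hB _) _ (abs_fgnCov_one_lt (by norm_num) (by norm_num)), mul_zero]
  intro i j
  rw [covariance_incrementQuad hB, fgnCov_half (x := k) (by linarith),
    fgnCov_half (x := k + 1) (by linarith), fgnCov_half (x := k + -1) (by linarith)]

lemma tendsto_changeAutocovariance_div (hB : IsStandardFractionalBrownianMotion H B P)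
    (hH : H < 1) :
    Tendsto (fun k : ℕ => changeAutocovariance B P k / (k : ℝ) ^ (4 * H - 4)) atTop
      (nhds (2 * (1 - fgnCov H 1) / (Real.pi ^ 2 * (1 + fgnCov H 1))
        * H ^ 2 * (2 * H - 1) ^ 2)) := by
  have hk : Tendsto (fun k : ℕ => (k : ℝ)) atTop atTop := tendsto_natCast_atTop_atTop
  have hpos : ∀ᶠ k : ℕ in atTop, (k : ℝ) ^ (2 * H - 2) ≠ 0 := by
    filter_upwards [eventually_gt_atTop 0] with k hk0
    exact (Real.rpow_pos_of_pos (by exact_mod_cast hk0) _).ne'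
  have hzero : Tendsto (fun k : ℕ => (k : ℝ) ^ (2 * H - 2)) atTop (nhds 0) := by
    have := (tendsto_rpow_neg_atTop (y := 2 - 2 * H) (by linarith)).comp hk
    simpa [Function.comp_def] using this
  have h0 : Tendsto (fun k : ℕ => fgnCov H k / (k : ℝ) ^ (2 * H - 2)) atTop
      (nhds (H * (2 * H - 1))) := by
    simpa using tendsto_fgnCov_add_div H 0
  have h := (tendsto_covariance_upSign_mul_upSign
    (Eventually.of_forall fun k => hasGaussianLaw_incrementQuad hB k)
    (Eventually.of_forall fun k i => integral_increment hB _)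
    (Eventually.of_forall fun k => covariance_incrementQuad hB k)
    (abs_fgnCov_one_lt hB.hurst_pos hH) hpos hzero h0 (tendsto_fgnCov_add_div H 1)
    (tendsto_fgnCov_add_div H (-1)) h0).const_mul (1 / 4)
  have e : 1 / 4 * (8 * (1 - fgnCov H 1) / (Real.pi ^ 2 * (1 + fgnCov H 1))
      * (H * (2 * H - 1)) ^ 2)
      = 2 * (1 - fgnCov H 1) / (Real.pi ^ 2 * (1 + fgnCov H 1)) * H ^ 2 * (2 * H - 1) ^ 2 := by
    ring
  rw [e] at h
  refine h.congr fun k => ?_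
  have e2 : ((k : ℝ) ^ (2 * H - 2)) ^ 2 = (k : ℝ) ^ (4 * H - 4) := by
    rw [← Real.rpow_natCast, ← Real.rpow_mul (by positivity)]
    congr 1
    push_cast; ring
  rw [changeAutocovariance_eq_incrementQuad hB, e2, mul_div_assoc]

end MainResult

theorem theorem3 {Ω : Type*} [MeasurableSpace Ω] (P : Measure Ω) [IsProbabilityMeasure P]
    (H : ℝ) (hH0 : 0 < H) (hH1 : H ≤ 1) (B : ℝ≥0 → Ω → ℝ)
    (hB : IsStandardFractionalBrownianMotion H B P) :
    IsEquivalent atTop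
      (fun k : ℕ => changeAutocovariance B P k)
      (fun k : ℕ =>
        2 * (1 - incrementAutocovariance B P 1)
            / (Real.pi ^ 2 * (1 + incrementAutocovariance B P 1))
          * H ^ 2 * (2 * H - 1) ^ 2 * (k : ℝ) ^ (4 * H - 4)) := by
  rw [incrementAutocovariance_one hB]
  rcases hH1.eq_or_lt with rfl | hlt
  · simp only [fgnCov_one_left, changeAutocovariance_of_hurst_one hB]
    simpa using IsEquivalent.refl
  by_cases hhalf : H = 1 / 2
  · subst hhalf
    have e : (fun k : ℕ => 2 * (1 - fgnCov (1 / 2) 1) / (Real.pi ^ 2 * (1 + fgnCov (1 / 2) 1))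
        * (1 / 2) ^ 2 * (2 * (1 / 2) - 1) ^ 2 * (k : ℝ) ^ (4 * (1 / 2) - 4 : ℝ)) = 0 := by
      ext k; norm_num
    rw [e, isEquivalent_zero_iff_eventually_zero]
    filter_upwards [eventually_ge_atTop 2] with k hk
    exact changeAutocovariance_of_hurst_half hB hk
  have hr := abs_lt.1 (abs_fgnCov_one_lt hH0 hlt)
  set c := 2 * (1 - fgnCov H 1) / (Real.pi ^ 2 * (1 + fgnCov H 1)) * H ^ 2 * (2 * H - 1) ^ 2 with hc
  have hc0 : c ≠ 0 := by
    have h1 : 0 < 1 - fgnCov H 1 := by linarith [hr.2]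
    have h2 : 0 < 1 + fgnCov H 1 := by linarith [hr.1]
    have h3 : 2 * H - 1 ≠ 0 := fun h => hhalf (by linarith)
    have := Real.pi_pos
    positivity
  have hk0 : ∀ᶠ k : ℕ in atTop, 0 < (k : ℝ) ^ (4 * H - 4) := by
    filter_upwards [eventually_gt_atTop 0] with k hk
    exact Real.rpow_pos_of_pos (by exact_mod_cast hk) _
  rw [isEquivalent_iff_tendsto_one (by filter_upwards [hk0] with k hk using mul_ne_zero hc0 hk.ne')]
  have h := (tendsto_changeAutocovariance_div hB hlt).div_const c
  rw [div_self hc0] at h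
  refine h.congr fun k => ?_
  rw [Pi.div_apply, div_div, mul_comm c]
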